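/- Let $G$ be a positive semidefinite self-adjoint (densely defined, possibly unbounded) operator on a complex Hilbert space $\mathcal H$ such that $\inf\{\|G\varphi\| : \varphi\in\mathcal D(G),\ \|\varphi\|=1\}=0$. Write $\langle\varphi|G|\varphi\rangle=\|\sqrt G\varphi\|^2$ if $\varphi\in\mathcal D(\sqrt G)$ and $\langle\varphi|G|\varphi\rangle=+\infty$ otherwise, and for $E>0$ and a bounded operator $A\in\mathfrak B(\mathcal H)$ let $$\|A\|^G_E=\sup\{\|A\varphi\| : \varphi\in\mathcal H,\ \|\varphi\|=1,\ \langle\varphi|G|\varphi\rangle\le E\}$$ (the operator $E$-norm). Let $G_1$ and $G_2$ be two such operators on Hilbert spaces $\mathcal H_1$ and $\mathcal H_2$. On the Hilbert space tensor product $\mathcal H_1\otimes\mathcal H_2$ let $G_1\otimes I_2$ be the closure of the operator $x\otimes y\mapsto G_1x\otimes y$ on the algebraic tensor product of $\mathcal D(G_1)$ and $\mathcal H_2$, and let $G_{12}=G_1\otimes I_2+I_1\otimes G_2$ be the closure of the operator $x\otimes y\mapsto G_1x\otimes y+x\otimes G_2y$ on the algebraic tensor product of $\mathcal D(G_1)$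 and $\mathcal D(G_2)$. Let $E>0$. A) For every $A\in\mathfrak B(\mathcal H_1)$, $$\|A\otimes I_2\|^{G_{12}}_E=\|A\otimes I_2\|^{G_1\otimes I_2}_E=\|A\|^{G_1}_E.$$ B) For all $A\in\mathfrak B(\mathcal H_1)$ and $B\in\mathfrak B(\mathcal H_2)$, $$\sup_{x\in(0,E)}\|A\|^{G_1}_x\|B\|^{G_2}_{E-x}\ \le\ \|A\otimes B\|^{G_{12}}_E\ \le\ \sup_{x\in(0,E)}\sqrt{\|A^*A\|^{G_1}_x\,\|B^*B\|^{G_2}_{E-x}}$$ and $$\|A\otimes B\|^{G_{12}}_E\ \le\ \min\{\|A\|^{G_1}_E\|B\|,\ \|A\|\,\|B\|^{G_2}_E\}.$$ -/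

import Mathlib

open scoped TensorProduct ENNReal

noncomputable section

namespace OperatorENorm

universe u v

section OneSpace

variable {H : Type u} [NormedAddCommGroup H] [InnerProductSpace ℂ H] [CompleteSpace H]

/-- A (possibly unbounded) positive semidefinite self-adjoint operator with dense domain. -/
structure IsPositiveSelfAdjoint (T : H →ₗ.[ℂ] H) : Prop where
  dense_domain : Dense (T.domain : Set H)
  isSelfAdjoint : IsSelfAdjoint T
  nonneg : ∀ φ : T.domain, 0 ≤ (inner ℂ (φ : H) (T φ)).re

/-- `inf {‖G φ‖ : φ ∈ D(G), ‖φ‖ = 1} = 0`.  (This fails when there is no unit vector in `D(G)`.) -/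
def InfIsZero (G : H →ₗ.[ℂ] H) : Prop :=
  IsGLB {r : ℝ | ∃ φ : G.domain, ‖(φ : H)‖ = 1 ∧ r = ‖G φ‖} 0

/-- `S` is a positive square root of `G`: `S` is positive self-adjoint and `S ∘ S = G` as partially
defined operators, i.e. `φ ∈ D(G)` iff `φ ∈ D(S)` and `S φ ∈ D(S)`, and then `G φ = S (S φ)`. -/
def IsPositiveSqrt (S G : H →ₗ.[ℂ] H) : Prop :=
  IsPositiveSelfAdjoint S ∧
    ∀ φ η : H, (φ, η) ∈ G.graph ↔ ∃ ψ : H, (φ, ψ) ∈ S.graph ∧ (ψ, η) ∈ S.graph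

open Classical in
/-- The operator `√G`: the unique positive self-adjoint square root of a positive self-adjoint
operator `G` (and `⊥`, the operator with domain `{0}`, if `G` has no positive square root). -/
def opSqrt (G : H →ₗ.[ℂ] H) : H →ₗ.[ℂ] H :=
  if h : ∃ S : H →ₗ.[ℂ] H, IsPositiveSqrt S G then h.choose else ⊥

open Classical in
/-- `⟨φ|G|φ⟩`, which is `‖√G φ‖²` if `φ ∈ D(√G)` and `+∞` otherwise. -/
def energy (G : H →ₗ.[ℂ] H) (φ : H) : ℝ≥0∞ :=
  if h : φ ∈ (opSqrt G).domain then ENNReal.ofReal (‖opSqrt G ⟨φ, h⟩‖ ^ 2) else ⊤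

/-- The operator E-norm `‖A‖^G_E`: the supremum of `‖A φ‖` over all unit vectors `φ` such that
`⟨φ|G|φ⟩ ≤ E`. -/
def eNorm (G : H →ₗ.[ℂ] H) (E : ℝ) (A : H →L[ℂ] H) : ℝ :=
  sSup ((fun φ : H => ‖A φ‖) '' {φ : H | ‖φ‖ = 1 ∧ energy G φ ≤ ENNReal.ofReal E})

/-- The supremum defining the E-norm is over a bounded set. -/
theorem bddAbove_eNorm (G : H →ₗ.[ℂ] H) (E : ℝ) (A : H →L[ℂ] H) :
    BddAbove ((fun φ : H => ‖A φ‖) '' {φ : H | ‖φ‖ = 1 ∧ energy G φ ≤ ENNReal.ofReal E}) := by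
  refine ⟨‖A‖, ?_⟩
  rintro _ ⟨φ, ⟨hφ, -⟩, rfl⟩
  simpa [hφ] using A.le_opNorm φ

end OneSpace

section TwoSpaces

variable (H₁ : Type u) (H₂ : Type v)
  [NormedAddCommGroup H₁] [InnerProductSpace ℂ H₁]
  [NormedAddCommGroup H₂] [InnerProductSpace ℂ H₂]

/-- The Hilbert space tensor product: the completion of the algebraic tensor product with respect
to the inner product `⟪x ⊗ y, x' ⊗ y'⟫ = ⟪x, x'⟫ ⟪y, y'⟫`. -/
abbrev HilbertTensor : Type (max u v) := UniformSpace.Completion (H₁ ⊗[ℂ] H₂)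

variable {H₁ H₂}

/-- The embedding of the algebraic tensor product `D₁ ⊗ D₂` of two subspaces into the Hilbert space
tensor product. -/
def tensorEmbed (D₁ : Submodule ℂ H₁) (D₂ : Submodule ℂ H₂) :
    D₁ ⊗[ℂ] D₂ →ₗ[ℂ] HilbertTensor H₁ H₂ :=
  (UniformSpace.Completion.toComplL (𝕜 := ℂ) (E := H₁ ⊗[ℂ] H₂)).toLinearMap ∘ₗ
    TensorProduct.map D₁.subtype D₂.subtype

theorem tensorEmbed_injective (D₁ : Submodule ℂ H₁) (D₂ : Submodule ℂ H₂) :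
    Function.Injective (tensorEmbed D₁ D₂) := by
  have h : Function.Injective (TensorProduct.map D₁.subtype D₂.subtype) :=
    TensorProduct.map_injective_of_flat_flat _ _ D₁.injective_subtype D₂.injective_subtype
  exact (UniformSpace.Completion.coe_injective (H₁ ⊗[ℂ] H₂)).comp h

/-- The operator on the Hilbert space tensor product with domain the algebraic tensor product
`D₁ ⊗ D₂` that acts there as the linear map `L`. -/
def tensorPMap (D₁ : Submodule ℂ H₁) (D₂ : Submodule ℂ H₂)
    (L : D₁ ⊗[ℂ] D₂ →ₗ[ℂ] H₁ ⊗[ℂ] H₂) : HilbertTensor H₁ H₂ →ₗ.[ℂ] HilbertTensor H₁ H₂ where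
  domain := LinearMap.range (tensorEmbed D₁ D₂)
  toFun := (UniformSpace.Completion.toComplL (𝕜 := ℂ) (E := H₁ ⊗[ℂ] H₂)).toLinearMap ∘ₗ L ∘ₗ
    (LinearEquiv.ofInjective (tensorEmbed D₁ D₂) (tensorEmbed_injective D₁ D₂)).symm.toLinearMap

variable (H₂) in
/-- `G₁ ⊗ I`: the closure of the operator `x ⊗ y ↦ G₁ x ⊗ y` on the algebraic tensor product of
`D(G₁)` and `H₂`. -/
def opTensorId (G₁ : H₁ →ₗ.[ℂ] H₁) : HilbertTensor H₁ H₂ →ₗ.[ℂ] HilbertTensor H₁ H₂ :=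
  (tensorPMap G₁.domain (⊤ : Submodule ℂ H₂)
    (TensorProduct.map G₁.toFun (⊤ : Submodule ℂ H₂).subtype)).closure

/-- `G₁ ⊗ I + I ⊗ G₂`: the closure of the operator `x ⊗ y ↦ G₁ x ⊗ y + x ⊗ G₂ y` on the algebraic
tensor product of `D(G₁)` and `D(G₂)`. -/
def opTensorSum (G₁ : H₁ →ₗ.[ℂ] H₁) (G₂ : H₂ →ₗ.[ℂ] H₂) :
    HilbertTensor H₁ H₂ →ₗ.[ℂ] HilbertTensor H₁ H₂ :=
  (tensorPMap G₁.domain G₂.domain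
    (TensorProduct.map G₁.toFun G₂.domain.subtype +
      TensorProduct.map G₁.domain.subtype G₂.toFun)).closure

/-- The bounded operator `A ⊗ B` on the Hilbert space tensor product: the continuous extension of
`x ⊗ y ↦ A x ⊗ B y`. -/
def tensorCLM (A : H₁ →L[ℂ] H₁) (B : H₂ →L[ℂ] H₂) :
    HilbertTensor H₁ H₂ →L[ℂ] HilbertTensor H₁ H₂ :=
  ((UniformSpace.Completion.toComplL (𝕜 := ℂ) (E := H₁ ⊗[ℂ] H₂)) ∘L
    TensorProduct.mapL A B).extend
      (UniformSpace.Completion.toComplL (𝕜 := ℂ) (E := H₁ ⊗[ℂ] H₂))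

end TwoSpaces

end OperatorENorm

end

/-! Two tools carry the proof: a description of the energy that avoids square roots, and Lagrange
duality for the E-norm.

Let `T` be positive, symmetric and densely defined, with `1 + T` of dense range. Then the energy of
its closure is at most `E` at `φ` exactly when vectors of `D(T)` converging to `φ` have quadratic
form at most `E` in the limit (`IsPositiveCore.energy_le_iff`). The algebraic operators defining `G₁
⊗ I` and `G₁ ⊗ I + I ⊗ G₂` are of this kind, so energies on the tensor product are computed from
algebraic tensors alone.

Duality (`IsPositiveSelfAdjoint.exists_dual`) comes from the S-lemma: there are `l, c ≥ 0` with `A*A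
≤ l G + c` as forms on `D(G)` and `l E + c ≤ ‖A‖_E²`. Unlike the supremum defining the norm, such a
form inequality survives tensoring with the identity: expand the second factor in an orthonormal
system.

For the upper bounds, a unit vector `w` of energy at most `E` yields `α, β ≥ 0` with `α + β ≤ E`
such that dual pairs for `G₁` and `G₂` may be evaluated at `α` and `β` (`exists_energy_split`). Part
A and the bound by the minimum follow at once; the square-root bound also uses Cauchy–Schwarz for
`A*A ⊗ B*B = (A*A ⊗ I)(I ⊗ B*B)`. The lower bounds come from product vectors, whose energies add.
Where the open interval `(0, E)` excludes endpoints, or a little energy must be spared for the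
second factor, energies are scaled by `t < 1` and `t → 1`. -/

noncomputable section

namespace OperatorENorm

/-! ### Resolvents, square roots and the energy as a relaxed quadratic form. -/

section Abstract

open scoped InnerProductSpace LinearPMap
open Topology

variable {H : Type*} [NormedAddCommGroup H] [InnerProductSpace ℂ H]

/-- A densely defined positive symmetric operator `T` such that `1 + T` has dense range, i.e.
which is essentially self-adjoint. -/
structure IsPositiveCore (T : H →ₗ.[ℂ] H) : Prop where
  dense_domain : Dense (T.domain : Set H)
  symm : T.IsFormalAdjoint T
  nonneg : ∀ φ : T.domain, 0 ≤ (⟪(φ : H), T φ⟫_ℂ).re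
  dense_range : DenseRange (fun φ : T.domain => (φ : H) + T φ)

theorem re_inner_self (x : H) : (⟪x, x⟫_ℂ).re = ‖x‖ ^ 2 :=
  inner_self_eq_norm_sq (𝕜 := ℂ) x

theorem re_inner_add (x y : H) : (⟪x, x + y⟫_ℂ).re = ‖x‖ ^ 2 + (⟪x, y⟫_ℂ).re := by
  rw [inner_add_right, Complex.add_re, re_inner_self]

namespace IsPositiveCore

variable {T : H →ₗ.[ℂ] H}

section

variable (hT : IsPositiveCore T)
include hT

theorem norm_le (χ : T.domain) : ‖(χ : H)‖ ≤ 1 * ‖(χ : H) + T χ‖ := by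
  have h1 := re_inner_add (χ : H) (T χ)
  have h2 := hT.nonneg χ
  have h3 : (⟪(χ : H), (χ : H) + T χ⟫_ℂ).re ≤ ‖(χ : H)‖ * ‖(χ : H) + T χ‖ :=
    re_inner_le_norm (𝕜 := ℂ) _ _
  rcases (norm_nonneg (χ : H)).eq_or_lt with h | h
  · rw [← h]; positivity
  · nlinarith

variable [CompleteSpace H]

theorem isClosable : T.IsClosable :=
  LinearPMap.isClosable_iff_exists_closed_extension.2
    ⟨T†, LinearPMap.adjoint_isClosed hT.dense_domain, hT.symm.le_adjoint hT.dense_domain⟩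

/-- The bounded operator `(1 + T)⁻¹`. -/
theorem exists_resolvent : ∃ R : H →L[ℂ] H, (∀ χ : T.domain, R ((χ : H) + T χ) = χ) ∧
    0 ≤ R ∧ R ≤ 1 ∧ (∀ x, R x = 0 → x = 0) ∧
    ∀ φ η : H, (φ, η) ∈ T.closure.graph ↔ φ = R (φ + η) := by
  set e : T.domain →ₗ[ℂ] H := T.domain.subtype + T.toFun with he
  have hd : DenseRange e := hT.dense_range
  have hb : ∃ C : ℝ, ∀ x, ‖T.domain.subtype x‖ ≤ C * ‖e x‖ := ⟨1, hT.norm_le⟩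
  -- `R` extends `χ + T χ ↦ χ`, a contraction on a dense subspace by `norm_le`; its properties are
  -- checked on that subspace and extended by continuity.
  set R : H →L[ℂ] H := T.domain.subtype.extendOfNorm e with hR
  have hRe : ∀ χ : T.domain, R ((χ : H) + T χ) = χ := fun χ =>
    LinearMap.extendOfNorm_eq hd hb χ
  have hsymm : ∀ x y, ⟪R x, y⟫_ℂ = ⟪x, R y⟫_ℂ := by
    intro x y
    refine hd.induction_on₂ (p := fun x y => ⟪R x, y⟫_ℂ = ⟪x, R y⟫_ℂ)
      (isClosed_eq (by fun_prop) (by fun_prop)) ?_ x y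
    intro a b
    change ⟪R ((a : H) + T a), (b : H) + T b⟫_ℂ = ⟪(a : H) + T a, R ((b : H) + T b)⟫_ℂ
    rw [hRe, hRe, inner_add_left, inner_add_right, hT.symm]
  have h0 : 0 ≤ R := by
    rw [ContinuousLinearMap.nonneg_iff_isPositive]
    refine ⟨hsymm, fun x => ?_⟩
    refine hd.induction_on (p := fun x => 0 ≤ R.reApplyInnerSelf x) x
      (isClosed_le (by fun_prop) R.reApplyInnerSelf_continuous) ?_
    intro a
    change 0 ≤ (⟪R ((a : H) + T a), (a : H) + T a⟫_ℂ).re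
    rw [hRe, re_inner_add]
    have := hT.nonneg a
    positivity
  have h1 : R ≤ 1 := by
    rw [ContinuousLinearMap.le_def]
    refine ⟨fun x y => ?_, fun x => ?_⟩
    · change ⟪x - R x, y⟫_ℂ = ⟪x, y - R y⟫_ℂ
      rw [inner_sub_left, inner_sub_right, hsymm]
    refine hd.induction_on (p := fun x => 0 ≤ (1 - R).reApplyInnerSelf x) x
      (isClosed_le (by fun_prop) (1 - R).reApplyInnerSelf_continuous) ?_
    intro a
    change 0 ≤ (⟪(a : H) + T a - R ((a : H) + T a), (a : H) + T a⟫_ℂ).re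
    rw [hRe, add_sub_cancel_left, inner_add_right, Complex.add_re, ← inner_conj_symm,
      Complex.conj_re, re_inner_self]
    have := hT.nonneg a
    positivity
  refine ⟨R, hRe, h0, h1, fun x hx => ?_, fun φ η => ?_⟩
  · refine hT.dense_domain.eq_zero_of_inner_left ℂ fun v hv => ?_
    have := hRe ⟨v, hv⟩
    change ⟪x, ((⟨v, hv⟩ : T.domain) : H)⟫_ℂ = 0
    rw [← this, ← hsymm, hx, inner_zero_left]
  · rw [← hT.isClosable.graph_closure_eq_closure_graph]
    constructor
    · intro h
      have hc : IsClosed {p : H × H | p.1 = R (p.1 + p.2)} :=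
        isClosed_eq (by fun_prop) (by fun_prop)
      have : (T.graph : Set (H × H)) ⊆ {p : H × H | p.1 = R (p.1 + p.2)} := by
        rintro ⟨a, b⟩ hab
        obtain ⟨χ, rfl, rfl⟩ := (LinearPMap.mem_graph_iff _).1 hab
        exact (hRe χ).symm
      exact closure_minimal this hc h
    · intro h
      -- The set `φ = R (φ + η)` is the continuous image of `w ↦ (R w, w - R w)`, and the dense set
      -- of `w = χ + T χ` lands in the graph of `T`.
      have : (φ, η) = (fun w => (R w, w - R w)) (φ + η) := by
        ext <;> simp [← h]
      rw [this]
      refine hd.induction_on (p := fun w => (R w, w - R w) ∈ T.graph.topologicalClosure) _ ?_ ?_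
      · exact T.graph.isClosed_topologicalClosure.preimage (by fun_prop)
      · intro χ
        refine T.graph.le_topologicalClosure ?_
        change (R ((χ : H) + T χ), (χ : H) + T χ - R ((χ : H) + T χ)) ∈ _
        rw [hRe, add_sub_cancel_left]
        exact T.mem_graph χ

end

end IsPositiveCore

theorem mem_ker_sub_iff (P Q : H →L[ℂ] H) (φ ψ : H) :
    (φ, ψ) ∈ LinearMap.ker ((Q ∘L ContinuousLinearMap.fst ℂ H H -
      P ∘L ContinuousLinearMap.snd ℂ H H : H × H →L[ℂ] H) : H × H →ₗ[ℂ] H) ↔ Q φ = P ψ := by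
  simp [sub_eq_zero]

variable [CompleteSpace H]

/-- For `0 ≤ R ≤ 1` injective, the operator `R⁻¹ - 1` has a positive square root. -/
theorem exists_sqrt_of_resolvent {R : H →L[ℂ] H} (h0 : 0 ≤ R) (h1 : R ≤ 1)
    (hinj : ∀ x, R x = 0 → x = 0) :
    ∃ S : H →ₗ.[ℂ] H, IsPositiveSelfAdjoint S ∧
      ∀ φ η : H, φ = R (φ + η) ↔ ∃ ψ, (φ, ψ) ∈ S.graph ∧ (ψ, η) ∈ S.graph := by
  have h1' : 0 ≤ 1 - R := sub_nonneg.2 h1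
  -- Formally `R = (1 + G)⁻¹`, so `√G = P⁻¹ Q` with commuting `P = √R` and `Q = √(1 - R)`. Since `P²
  -- + Q² = 1`, the graph `Q φ = P ψ` is parametrized by `u ↦ (P u, Q u)`, with inverse `(a, b) ↦ P
  -- a + Q b`.
  set P := CFC.sqrt R with hP
  set Q := CFC.sqrt (1 - R) with hQ
  have hP0 : 0 ≤ P := CFC.sqrt_nonneg R
  have hQ0 : 0 ≤ Q := CFC.sqrt_nonneg (1 - R)
  have hPP : P * P = R := CFC.sqrt_mul_sqrt_self R h0
  have hQQ : Q * Q = 1 - R := CFC.sqrt_mul_sqrt_self (1 - R) h1'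
  have hcomm : Commute P Q := by
    have : Commute R (1 - R) := (Commute.one_right R).sub_right rfl
    exact (this.cfcₙ_nnreal _).symm.cfcₙ_nnreal _ |>.symm
  have hPQ0 : 0 ≤ P * Q := hcomm.mul_nonneg hP0 hQ0
  have hPp := (ContinuousLinearMap.nonneg_iff_isPositive _).1 hP0
  have hQp := (ContinuousLinearMap.nonneg_iff_isPositive _).1 hQ0
  have hPQp := (ContinuousLinearMap.nonneg_iff_isPositive _).1 hPQ0
  have ePP : ∀ x, P (P x) = R x := fun x => congr($hPP x)
  have eQQ : ∀ x, Q (Q x) = x - R x := fun x => congr($hQQ x)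
  have ePQ : ∀ x, P (Q x) = Q (P x) := fun x => congr($hcomm.eq x)
  have hPinj : ∀ x, P x = 0 → x = 0 := fun x hx => hinj x (by rw [← ePP, hx, map_zero])
  set g : Submodule ℂ (H × H) := LinearMap.ker ((Q ∘L ContinuousLinearMap.fst ℂ H H -
      P ∘L ContinuousLinearMap.snd ℂ H H : H × H →L[ℂ] H) : H × H →ₗ[ℂ] H) with hg
  have hgr : g.toLinearPMap.graph = g := by
    refine Submodule.toLinearPMap_graph_eq g ?_
    rintro ⟨a, b⟩ hab ha
    have ha' : a = 0 := ha
    have := (mem_ker_sub_iff P Q a b).1 hab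
    rw [ha', map_zero] at this
    exact hPinj b this.symm
  set S := g.toLinearPMap with hS
  have hmem : ∀ φ ψ, (φ, ψ) ∈ S.graph ↔ Q φ = P ψ := fun φ ψ => by
    rw [hgr]; exact mem_ker_sub_iff P Q φ ψ
  have hpar : ∀ u, (P u, Q u) ∈ S.graph := fun u => (hmem _ _).2 (ePQ u).symm
  have hdense : Dense (S.domain : Set H) := by
    rw [Submodule.dense_iff_topologicalClosure_eq_top, Submodule.topologicalClosure_eq_top_iff,
      eq_bot_iff]
    intro v hv
    refine hPinj v ?_
    rw [← inner_self_eq_zero (𝕜 := ℂ), hPp.inner_left_eq_inner_right, ← hPp.inner_left_eq_inner_right,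
      hPp.inner_left_eq_inner_right]
    have hd : P (P v) ∈ S.domain := LinearPMap.mem_domain_of_mem_graph (hpar (P v))
    exact (Submodule.mem_orthogonal' _ _).1 hv _ hd
  refine ⟨S, ⟨hdense, ?_, ?_⟩, fun φ η => ?_⟩
  · rw [LinearPMap.isSelfAdjoint_def]
    refine LinearPMap.eq_of_eq_graph ?_
    rw [LinearPMap.adjoint_graph_eq_graph_adjoint hdense]
    ext ⟨φ, ψ⟩
    rw [Submodule.mem_adjoint_iff, hmem]
    -- Testing against the pairs `(P u, Q u)` turns membership in the adjoint graph into `Q φ = P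
    -- ψ`, the equation of the graph itself.
    constructor
    · intro h
      refine ext_inner_left ℂ fun u => ?_
      rw [← hQp.inner_left_eq_inner_right, ← hPp.inner_left_eq_inner_right]
      exact sub_eq_zero.1 (h _ _ (hpar u))
    · intro h a b hab
      have hab' := (hmem a b).1 hab
      have ha : P (P a + Q b) = a := by
        rw [map_add, ePP, ePQ, ← hab', eQQ]; abel
      have hb : Q (P a + Q b) = b := by
        rw [map_add, ← ePQ, hab', ePP, eQQ]; abel
      set u := P a + Q b
      rw [← ha, ← hb, hPp.inner_left_eq_inner_right, hQp.inner_left_eq_inner_right]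
      simp [h]
  · intro φ
    have hab' := (hmem φ (S φ)).1 (S.mem_graph φ)
    have ha : P (P φ + Q (S φ)) = φ := by
      rw [map_add, ePP, ePQ, ← hab', eQQ]; abel
    have hb : Q (P φ + Q (S φ)) = S φ := by
      rw [map_add, ← ePQ, hab', ePP, eQQ]; abel
    set u := P φ + Q (S φ)
    rw [← hb]
    nth_rewrite 1 [← ha]
    rw [hPp.inner_left_eq_inner_right]
    exact hPQp.re_inner_nonneg_right u
  · constructor
    · intro h
      refine ⟨P (Q (φ + η)), (hmem _ _).2 ?_, (hmem _ _).2 ?_⟩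
      · nth_rewrite 1 [h]
        rw [← ePP, ePQ, ePQ]
      · have : η = (φ + η) - R (φ + η) := by rw [← h]; abel
        nth_rewrite 2 [this]
        rw [← eQQ, ePQ, ePQ, ePQ]
    · rintro ⟨ψ, h2, h3⟩
      rw [hmem] at h2 h3
      have : Q (Q φ) = P (P η) := by rw [h2, ← ePQ, h3]
      rw [eQQ, ePP] at this
      rw [map_add, ← this]; abel

theorem IsPositiveCore.exists_isPositiveSqrt {T : H →ₗ.[ℂ] H} (hT : IsPositiveCore T) :
    ∃ S, IsPositiveSqrt S T.closure := by
  obtain ⟨R, -, h0, h1, hi, hgr⟩ := hT.exists_resolvent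
  obtain ⟨S, hS, h⟩ := exists_sqrt_of_resolvent h0 h1 hi
  exact ⟨S, hS, fun φ η => (hgr φ η).trans (h φ η)⟩

/-- Uniqueness of the root is not needed: the energy is later computed from any positive square
root. -/
theorem IsPositiveCore.isPositiveSqrt_opSqrt {T : H →ₗ.[ℂ] H} (hT : IsPositiveCore T) :
    IsPositiveSqrt (opSqrt T.closure) T.closure := by
  have h := hT.exists_isPositiveSqrt
  rw [opSqrt, dif_pos h]
  exact h.choose_spec

theorem IsPositiveSelfAdjoint.isFormalAdjoint {G : H →ₗ.[ℂ] H} (hG : IsPositiveSelfAdjoint G) :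
    G.IsFormalAdjoint G := by
  have := LinearPMap.adjoint_isFormalAdjoint hG.dense_domain
  rwa [LinearPMap.isSelfAdjoint_def.1 hG.isSelfAdjoint] at this

theorem IsPositiveSelfAdjoint.closure_eq {G : H →ₗ.[ℂ] H} (hG : IsPositiveSelfAdjoint G) :
    G.closure = G := by
  have hc := hG.isSelfAdjoint.isClosed
  refine LinearPMap.eq_of_eq_graph ?_
  rw [← hc.isClosable.graph_closure_eq_closure_graph]
  exact hc.submodule_topologicalClosure_eq

theorem IsPositiveSelfAdjoint.mem_graph_of_inner {S : H →ₗ.[ℂ] H} (hS : IsPositiveSelfAdjoint S)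
    {φ ψ : H} (h : ∀ x : S.domain, ⟪ψ, (x : H)⟫_ℂ = ⟪φ, S x⟫_ℂ) : (φ, ψ) ∈ S.graph := by
  have hd : φ ∈ (S†).domain := LinearPMap.mem_adjoint_domain_of_exists φ ⟨ψ, h⟩
  have h2 := LinearPMap.adjoint_apply_eq hS.dense_domain ⟨φ, hd⟩ h
  have hgr : (φ, ψ) ∈ (S†).graph := by
    rw [← h2]; exact (S†).mem_graph ⟨φ, hd⟩
  rwa [LinearPMap.isSelfAdjoint_def.1 hS.isSelfAdjoint] at hgr

/-- A vector orthogonal to the range of `1 + G` lies in `D(G*) = D(G)` and satisfies `G v = -v`,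
which positivity allows only for `v = 0`. -/
theorem IsPositiveSelfAdjoint.isPositiveCore {G : H →ₗ.[ℂ] H} (hG : IsPositiveSelfAdjoint G) :
    IsPositiveCore G where
  dense_domain := hG.dense_domain
  symm := hG.isFormalAdjoint
  nonneg := hG.nonneg
  dense_range := by
    have : Dense ((LinearMap.range (G.domain.subtype + G.toFun) : Submodule ℂ H) : Set H) := by
      rw [Submodule.dense_iff_topologicalClosure_eq_top,
        Submodule.topologicalClosure_eq_top_iff, eq_bot_iff]
      intro v hv
      have hv' : ∀ x : G.domain, ⟪-v, (x : H)⟫_ℂ = ⟪v, G x⟫_ℂ := fun x => by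
        have := (Submodule.mem_orthogonal' _ _).1 hv _ ⟨x, rfl⟩
        change ⟪v, (x : H) + G x⟫_ℂ = 0 at this
        rw [inner_add_right] at this
        rw [inner_neg_left]
        linear_combination -this
      obtain ⟨w, hw, hw'⟩ := (LinearPMap.mem_graph_iff _).1 (hG.mem_graph_of_inner hv')
      simp only at hw hw'
      have := hG.nonneg w
      rw [hw', hw, inner_neg_right, Complex.neg_re, re_inner_self] at this
      have : ‖v‖ ^ 2 = 0 := le_antisymm (by linarith) (sq_nonneg _)
      simpa using this
    exact this

theorem IsPositiveSqrt.exists_apply {S G : H →ₗ.[ℂ] H} (hS : IsPositiveSqrt S G) {φ η : H}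
    (h : (φ, η) ∈ G.graph) : ∃ ψ, (φ, ψ) ∈ S.graph ∧ (ψ, η) ∈ S.graph :=
  (hS.2 φ η).1 h

theorem IsPositiveSelfAdjoint.inner_graph {S : H →ₗ.[ℂ] H} (hS : IsPositiveSelfAdjoint S)
    {a b c d : H} (h : (a, b) ∈ S.graph) (h' : (c, d) ∈ S.graph) : ⟪b, c⟫_ℂ = ⟪a, d⟫_ℂ := by
  obtain ⟨x, rfl, rfl⟩ := (LinearPMap.mem_graph_iff _).1 h
  obtain ⟨y, rfl, rfl⟩ := (LinearPMap.mem_graph_iff _).1 h'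
  exact hS.isFormalAdjoint x y

/-- The domain of `T` is a core for every positive square root of the closure of `T`. -/
theorem IsPositiveCore.mem_closure_of_mem_graph {T S : H →ₗ.[ℂ] H} (hT : IsPositiveCore T)
    (hS : IsPositiveSqrt S T.closure) {φ ψ : H} (h : (φ, ψ) ∈ S.graph) {ε : ℝ} (hε : 0 < ε) :
    ∃ χ : T.domain, ∃ ξ : H, ((χ : H), ξ) ∈ S.graph ∧ ‖(χ : H) - φ‖ < ε ∧ ‖ξ - ψ‖ < ε := by
  set e := WithLp.prodContinuousLinearEquiv 2 ℂ H H with he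
  -- `D` is the part of the graph of `S` over `D(T)`, in the Hilbert space product so that
  -- orthogonal projection is available. A graph element `q` orthogonal to `D` satisfies `0 = ⟪χ, q⟫
  -- + ⟪S χ, S q⟫ = ⟪χ + T χ, q⟫`, hence vanishes by density of the range.
  set D : Submodule ℂ (WithLp 2 (H × H)) :=
    (S.graph ⊓ T.domain.comap (LinearMap.fst ℂ H H)).comap (e : WithLp 2 (H × H) →ₗ[ℂ] H × H)
    with hD
  set K := D.topologicalClosure with hK
  have hKc : IsClosed (K : Set (WithLp 2 (H × H))) := D.isClosed_topologicalClosure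
  have hKS : ∀ z ∈ K, e z ∈ S.graph := by
    have hc : IsClosed {z : WithLp 2 (H × H) | e z ∈ S.graph} :=
      hS.1.isSelfAdjoint.isClosed.preimage e.continuous
    exact fun z hz => closure_minimal (fun w hw => hw.1) hc hz
  have : CompleteSpace K := hKc.completeSpace_coe
  obtain ⟨p, hp, q, hq, hpq⟩ := K.exists_add_mem_mem_orthogonal (WithLp.toLp 2 (φ, ψ))
  have hqS : (q.fst, q.snd) ∈ S.graph := by
    have : e q = (φ, ψ) - e p := by
      have := congrArg e hpq
      rw [map_add] at this
      rw [eq_sub_iff_add_eq, add_comm]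
      exact this.symm
    have h' : e q ∈ S.graph := by
      rw [this]; exact S.graph.sub_mem h (hKS p hp)
    exact h'
  have hq0 : q.fst = 0 := by
    have : ∀ χ : T.domain, ⟪(χ : H) + T χ, q.fst⟫_ℂ = 0 := by
      intro χ
      have hχ : ((χ : H), T χ) ∈ T.closure.graph :=
        LinearPMap.le_graph_of_le T.le_closure (T.mem_graph χ)
      obtain ⟨ξ, h1, h2⟩ := hS.exists_apply hχ
      have hd : WithLp.toLp 2 ((χ : H), ξ) ∈ D := ⟨h1, χ.2⟩
      have := (K.mem_orthogonal q).1 hq _ (D.le_topologicalClosure hd)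
      rw [WithLp.prod_inner_apply] at this
      change ⟪(χ : H), q.fst⟫_ℂ + ⟪ξ, q.snd⟫_ℂ = 0 at this
      rw [inner_add_left, hS.1.inner_graph h2 hqS]
      exact this
    refine ext_inner_left ℂ fun w => ?_
    rw [inner_zero_right]
    exact hT.dense_range.induction_on (p := fun w => ⟪w, q.fst⟫_ℂ = 0) w
      (isClosed_eq (by fun_prop) (by fun_prop)) this
  have hq1 : q.snd = 0 := LinearPMap.graph_fst_eq_zero_snd S hqS hq0
  have hpe : p = WithLp.toLp 2 (φ, ψ) := by
    have : q = 0 := by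
      apply e.injective
      rw [map_zero]
      exact Prod.ext hq0 hq1
    rw [hpq, this, add_zero]
  rw [hpe] at hp
  have hmem : (φ, ψ) ∈ closure {z : H × H | z ∈ S.graph ∧ z.1 ∈ T.domain} := by
    have := image_closure_subset_closure_image e.continuous ⟨_, hp, rfl⟩
    refine closure_mono ?_ this
    rintro _ ⟨z, hz, rfl⟩
    exact hz
  obtain ⟨⟨a, b⟩, ⟨h1, h2⟩, h3⟩ := Metric.mem_closure_iff.1 hmem ε hε
  rw [dist_comm, Prod.dist_eq, max_lt_iff, dist_eq_norm, dist_eq_norm] at h3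
  exact ⟨⟨a, h2⟩, b, h1, h3.1, h3.2⟩

theorem IsPositiveCore.re_inner_eq {T S : H →ₗ.[ℂ] H}
    (hS : IsPositiveSqrt S T.closure) {χ : T.domain} {ξ : H} (h : ((χ : H), ξ) ∈ S.graph) :
    (⟪(χ : H), T χ⟫_ℂ).re = ‖ξ‖ ^ 2 := by
  have hχ : ((χ : H), T χ) ∈ T.closure.graph :=
    LinearPMap.le_graph_of_le T.le_closure (T.mem_graph χ)
  obtain ⟨ξ', h1, h2⟩ := hS.exists_apply hχ
  obtain rfl : ξ = ξ' := S.mem_graph_snd_inj h h1 rfl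
  rw [← re_inner_self, hS.1.inner_graph h h2]

/-- The bound says that `φ` is in the domain of `S† = S`; density of the domain then gives `|⟪S φ,
v⟫| ≤ C ‖v‖` for every `v`, in particular for `v = S φ`. -/
theorem IsPositiveSelfAdjoint.exists_mem_graph_of_bound {S : H →ₗ.[ℂ] H}
    (hS : IsPositiveSelfAdjoint S) {φ : H} {C : ℝ} (hC : 0 ≤ C)
    (h : ∀ x : S.domain, ‖⟪φ, S x⟫_ℂ‖ ≤ C * ‖(x : H)‖) :
    ∃ ψ, (φ, ψ) ∈ S.graph ∧ ‖ψ‖ ≤ C := by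
  have hd : φ ∈ (S†).domain := by
    rw [LinearPMap.mem_adjoint_domain_iff]
    exact (LinearMap.mkContinuous ((innerₛₗ ℂ φ).comp S.toFun) C h).continuous
  rw [LinearPMap.isSelfAdjoint_def.1 hS.isSelfAdjoint] at hd
  have hgr := S.mem_graph ⟨φ, hd⟩
  set ψ := S ⟨φ, hd⟩
  refine ⟨ψ, hgr, ?_⟩
  have hb : ∀ v, ‖⟪ψ, v⟫_ℂ‖ ≤ C * ‖v‖ := by
    intro v
    refine hS.dense_domain.induction (P := fun v => ‖⟪ψ, v⟫_ℂ‖ ≤ C * ‖v‖) ?_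
      (isClosed_le (by fun_prop) (by fun_prop)) v
    intro v hv
    rw [hS.inner_graph hgr (S.mem_graph ⟨v, hv⟩)]
    exact h ⟨v, hv⟩
  have := hb ψ
  rw [inner_self_eq_norm_sq_to_K] at this
  rcases (norm_nonneg ψ).eq_or_lt with h0 | h0
  · rwa [← h0]
  · have h2 : ‖ψ‖ ^ 2 ≤ C * ‖ψ‖ := by simpa using this
    nlinarith

theorem energy_le_iff_exists {G : H →ₗ.[ℂ] H} {φ : H} {E : ℝ} (hE : 0 ≤ E) :
    energy G φ ≤ ENNReal.ofReal E ↔ ∃ ψ, (φ, ψ) ∈ (opSqrt G).graph ∧ ‖ψ‖ ^ 2 ≤ E := by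
  unfold energy
  split_ifs with h
  · rw [ENNReal.ofReal_le_ofReal_iff hE]
    refine ⟨fun h' => ⟨_, LinearPMap.mem_graph _ ⟨φ, h⟩, h'⟩, ?_⟩
    rintro ⟨ψ, h1, h2⟩
    rwa [← (opSqrt G).mem_graph_snd_inj (LinearPMap.mem_graph _ ⟨φ, h⟩) h1 rfl] at h2
  · simp only [top_le_iff, ENNReal.ofReal_ne_top, false_iff]
    rintro ⟨ψ, h1, -⟩
    exact h (LinearPMap.mem_domain_of_mem_graph h1)

/-- The energy associated with the closure of `T` is the lower semicontinuous relaxation of the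
quadratic form of `T`. -/
theorem IsPositiveCore.energy_le_iff {T : H →ₗ.[ℂ] H} (hT : IsPositiveCore T) {φ : H} {E : ℝ}
    (hE : 0 ≤ E) :
    energy T.closure φ ≤ ENNReal.ofReal E ↔
      ∀ ε > 0, ∃ χ : T.domain, ‖(χ : H) - φ‖ < ε ∧ (⟪(χ : H), T χ⟫_ℂ).re < E + ε := by
  have hS := hT.isPositiveSqrt_opSqrt
  rw [energy_le_iff_exists hE]
  set S := opSqrt T.closure
  constructor
  · rintro ⟨ψ, hψ, hψE⟩ ε hε
    have : ∀ᶠ δ in 𝓝 (0 : ℝ), (‖ψ‖ + δ) ^ 2 < E + ε ∧ δ < ε := by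
      refine .and ?_ (gt_mem_nhds hε)
      have hc : Filter.Tendsto (fun δ : ℝ => (‖ψ‖ + δ) ^ 2) (𝓝 0) (𝓝 ((‖ψ‖ + 0) ^ 2)) :=
        Continuous.tendsto (by fun_prop) 0
      refine hc.eventually_lt_const ?_
      rw [add_zero]; linarith
    obtain ⟨δ, ⟨h1, h2⟩, hδ⟩ := ((this.filter_mono nhdsWithin_le_nhds).and
      (self_mem_nhdsWithin : Set.Ioi (0 : ℝ) ∈ 𝓝[>] 0)).exists
    obtain ⟨χ, ξ, h3, h4, h5⟩ := hT.mem_closure_of_mem_graph hS hψ hδ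
    refine ⟨χ, h4.trans h2, ?_⟩
    rw [IsPositiveCore.re_inner_eq hS h3]
    refine lt_of_le_of_lt ?_ h1
    have : ‖ξ‖ ≤ ‖ψ‖ + δ := by
      have := norm_le_norm_add_norm_sub' ξ ψ
      linarith
    gcongr
  · intro h
    -- Replace `φ` by an approximant `χ` and move `S` across: `⟪χ, S x⟫ = ⟪S χ, x⟫` with `‖S χ‖² < E
    -- + ε`. The error `ε ‖S x‖` vanishes because `x` is fixed.
    have hb : ∀ x : S.domain, ‖⟪φ, S x⟫_ℂ‖ ≤ √E * ‖(x : H)‖ := by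
      intro x
      have hε : ∀ ε > 0, ‖⟪φ, S x⟫_ℂ‖ ≤ √(E + ε) * ‖(x : H)‖ + ε * ‖S x‖ := by
        intro ε hε
        obtain ⟨χ, h1, h2⟩ := h ε hε
        have hχ : ((χ : H), T χ) ∈ T.closure.graph :=
          LinearPMap.le_graph_of_le T.le_closure (T.mem_graph χ)
        obtain ⟨ξ, h3, h4⟩ := hS.exists_apply hχ
        have h5 := IsPositiveCore.re_inner_eq hS h3
        have h6 : ‖ξ‖ ≤ √(E + ε) := Real.le_sqrt_of_sq_le (by linarith)
        have h7 : ⟪φ, S x⟫_ℂ = ⟪ξ, (x : H)⟫_ℂ - ⟪(χ : H) - φ, S x⟫_ℂ := by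
          rw [hS.1.inner_graph h3 (S.mem_graph x), inner_sub_left]; ring
        rw [h7]
        refine (norm_sub_le _ _).trans (add_le_add ?_ ?_)
        · refine (norm_inner_le_norm _ _).trans ?_
          gcongr
        · refine (norm_inner_le_norm _ _).trans ?_
          gcongr
      have hc : Filter.Tendsto (fun ε : ℝ => √(E + ε) * ‖(x : H)‖ + ε * ‖S x‖) (𝓝[>] 0)
          (𝓝 (√(E + 0) * ‖(x : H)‖ + 0 * ‖S x‖)) :=
        (Continuous.tendsto (by fun_prop) 0).mono_left nhdsWithin_le_nhds
      have := ge_of_tendsto hc (Filter.eventually_of_mem self_mem_nhdsWithin hε)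
      simpa using this
    obtain ⟨ψ, h1, h2⟩ := hS.1.exists_mem_graph_of_bound (Real.sqrt_nonneg E) hb
    exact ⟨ψ, h1, (pow_le_pow_left₀ (norm_nonneg _) h2 2).trans_eq (Real.sq_sqrt hE)⟩

end Abstract

/-! ### The S-lemma and duality for the E-norm. -/

section Duality

open scoped InnerProductSpace
open Topology

variable {H : Type*} [NormedAddCommGroup H] [InnerProductSpace ℂ H]

/-- The real part of the quadratic form of a linear map defined on a subspace. -/
def quadForm {D : Submodule ℂ H} (L : D →ₗ[ℂ] H) (x : D) : ℝ := (⟪(x : H), L x⟫_ℂ).re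

theorem quadForm_add_smul {D : Submodule ℂ H} (L : D →ₗ[ℂ] H) (x y : D) (c : ℂ) :
    quadForm L (x + c • y) = quadForm L x + ‖c‖ ^ 2 * quadForm L y +
      (c * (⟪(x : H), L y⟫_ℂ + starRingEnd ℂ ⟪(y : H), L x⟫_ℂ)).re := by
  have h : (‖c‖ ^ 2 : ℝ) = c.re * c.re + c.im * c.im := by
    rw [Complex.sq_norm, Complex.normSq_apply]
  simp only [quadForm, h, map_add, map_smul, Submodule.coe_add, Submodule.coe_smul,
    inner_add_left, inner_add_right, inner_smul_left, inner_smul_right, Complex.add_re,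
    Complex.mul_re, Complex.mul_im, Complex.add_im, Complex.conj_re, Complex.conj_im]
  ring

/-- Rotating `b` onto the imaginary axis leaves a free sign, which is spent on `b'`. This is where
complex scalars enter the S-lemma. -/
theorem exists_phase (b b' : ℂ) : ∃ τ : ℂ, ‖τ‖ = 1 ∧ (τ * b).re = 0 ∧ 0 ≤ (τ * b').re := by
  obtain ⟨τ, h1, h2⟩ : ∃ τ : ℂ, ‖τ‖ = 1 ∧ (τ * b).re = 0 := by
    by_cases hb : b = 0
    · exact ⟨1, by simp, by simp [hb]⟩
    · have hb' : (‖b‖ : ℂ) ≠ 0 := by simpa using hb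
      refine ⟨Complex.I * starRingEnd ℂ b / ‖b‖, by simp [hb], ?_⟩
      have : Complex.I * starRingEnd ℂ b / ‖b‖ * b = Complex.I * (‖b‖ : ℝ) := by
        field_simp
        rw [Complex.conj_mul']
      rw [this]; simp
  rcases le_total 0 (τ * b').re with h | h
  · exact ⟨τ, h1, h2, h⟩
  · refine ⟨-τ, by simpa using h1, by rw [neg_mul, Complex.neg_re, h2, neg_zero], ?_⟩
    rw [neg_mul, Complex.neg_re]; linarith

/-- A combination `x + s τ y` is made null for `L`: the phase `τ` removes the `L` cross term and
keeps the `M` cross term nonnegative, and `s` balances the diagonal terms. The hypothesis at this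
vector gives the inequality. -/
theorem quadForm_cross_le {D : Submodule ℂ H} {L M : D →ₗ[ℂ] H}
    (h : ∀ x, quadForm L x ≤ 0 → quadForm M x ≤ 0) {x y : D} (hx : quadForm L x < 0)
    (hy : 0 < quadForm L y) : quadForm M x * quadForm L y ≤ quadForm M y * quadForm L x := by
  obtain ⟨τ, h1, h2, h3⟩ := exists_phase (⟪(x : H), L y⟫_ℂ + starRingEnd ℂ ⟪(y : H), L x⟫_ℂ)
    (⟪(x : H), M y⟫_ℂ + starRingEnd ℂ ⟪(y : H), M x⟫_ℂ)
  have hr : 0 ≤ -quadForm L x / quadForm L y := div_nonneg (by linarith) hy.le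
  set s := √(-quadForm L x / quadForm L y) with hs
  have hs2 : s ^ 2 * quadForm L y = -quadForm L x := by
    rw [hs, Real.sq_sqrt hr]; field_simp
  have hn : ‖(s : ℂ) * τ‖ ^ 2 = s ^ 2 := by rw [norm_mul, h1, mul_one]; simp
  have hL : quadForm L (x + ((s : ℂ) * τ) • y) = 0 := by
    rw [quadForm_add_smul, hn, hs2, mul_assoc, Complex.re_ofReal_mul, h2]; ring
  have hM := h _ hL.le
  rw [quadForm_add_smul, hn, mul_assoc, Complex.re_ofReal_mul] at hM
  have h4 : quadForm M x + s ^ 2 * quadForm M y ≤ 0 := by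
    have := mul_nonneg (Real.sqrt_nonneg (-quadForm L x / quadForm L y)) h3
    linarith
  have h5 := mul_nonpos_of_nonpos_of_nonneg h4 hy.le
  have h6 : (quadForm M x + s ^ 2 * quadForm M y) * quadForm L y =
      quadForm M x * quadForm L y - quadForm M y * quadForm L x := by
    linear_combination quadForm M y * hs2
  linarith

/-- The S-lemma for two quadratic forms on a complex vector space. -/
theorem exists_quadForm_le {D : Submodule ℂ H} {L M : D →ₗ[ℂ] H}
    (h : ∀ x, quadForm L x ≤ 0 → quadForm M x ≤ 0) {x₀ : D} (hx₀ : quadForm L x₀ < 0) :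
    ∃ l : ℝ, 0 ≤ l ∧ ∀ x, quadForm M x ≤ l * quadForm L x := by
  set s : Set ℝ := {r | ∃ x, quadForm L x < 0 ∧ r = quadForm M x / quadForm L x} with hs
  have hne : s.Nonempty := ⟨_, x₀, hx₀, rfl⟩
  have h0 : ∀ r ∈ s, 0 ≤ r := by
    rintro _ ⟨x, hx, rfl⟩
    exact div_nonneg_of_nonpos (h x hx.le) hx.le
  -- The multiplier is the least ratio `M / L` over `L < 0`; `quadForm_cross_le` places it above
  -- every ratio over `L > 0`.
  refine ⟨sInf s, Real.sInf_nonneg h0, fun y => ?_⟩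
  rcases lt_trichotomy (quadForm L y) 0 with hy | hy | hy
  · have := csInf_le ⟨0, h0⟩ (show quadForm M y / quadForm L y ∈ s from ⟨y, hy, rfl⟩)
    rwa [le_div_iff_of_neg hy] at this
  · rw [hy, mul_zero]; exact h y hy.le
  · rw [← div_le_iff₀ hy]
    refine le_csInf hne ?_
    rintro _ ⟨x, hx, rfl⟩
    rw [le_div_iff_of_neg hx, div_mul_eq_mul_div, le_div_iff₀ hy]
    exact quadForm_cross_le h hx hy

theorem InfIsZero.exists_lt {G : H →ₗ.[ℂ] H} (hG' : InfIsZero G) {ε : ℝ} (hε : 0 < ε) :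
    ∃ φ : G.domain, ‖(φ : H)‖ = 1 ∧ (⟪(φ : H), G φ⟫_ℂ).re < ε := by
  by_contra! hcon
  have : ε ≤ 0 := by
    refine hG'.2 ?_
    rintro _ ⟨φ, hφ, rfl⟩
    refine (hcon φ hφ).trans ?_
    have := re_inner_le_norm (𝕜 := ℂ) (φ : H) (G φ)
    rwa [hφ, one_mul] at this
  linarith

variable [CompleteSpace H]

theorem eNorm_nonneg (G : H →ₗ.[ℂ] H) (E : ℝ) (A : H →L[ℂ] H) :
    0 ≤ eNorm G E A := by
  refine Real.sSup_nonneg ?_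
  rintro _ ⟨φ, -, rfl⟩
  exact norm_nonneg _

theorem eNorm_le {G : H →ₗ.[ℂ] H} {E : ℝ} {A : H →L[ℂ] H} {C : ℝ} (hC : 0 ≤ C)
    (h : ∀ φ, ‖φ‖ = 1 → energy G φ ≤ ENNReal.ofReal E → ‖A φ‖ ≤ C) : eNorm G E A ≤ C := by
  refine Real.sSup_le ?_ hC
  rintro _ ⟨φ, ⟨h1, h2⟩, rfl⟩
  exact h φ h1 h2

theorem le_eNorm {G : H →ₗ.[ℂ] H} {E : ℝ} (A : H →L[ℂ] H) {φ : H} (h1 : ‖φ‖ = 1)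
    (h2 : energy G φ ≤ ENNReal.ofReal E) : ‖A φ‖ ≤ eNorm G E A :=
  le_csSup (bddAbove_eNorm G E A) ⟨φ, ⟨h1, h2⟩, rfl⟩

theorem eNorm_le_opNorm (G : H →ₗ.[ℂ] H) (E : ℝ) (A : H →L[ℂ] H) : eNorm G E A ≤ ‖A‖ :=
  eNorm_le (norm_nonneg _) fun φ h1 _ => by simpa [h1] using A.le_opNorm φ

theorem IsPositiveSelfAdjoint.energy_le_iff {G : H →ₗ.[ℂ] H} (hG : IsPositiveSelfAdjoint G)
    {φ : H} {E : ℝ} (hE : 0 ≤ E) :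
    energy G φ ≤ ENNReal.ofReal E ↔
      ∀ ε > 0, ∃ χ : G.domain, ‖(χ : H) - φ‖ < ε ∧ (⟪(χ : H), G χ⟫_ℂ).re < E + ε := by
  have := hG.isPositiveCore.energy_le_iff (φ := φ) hE
  rwa [hG.closure_eq] at this

theorem IsPositiveSelfAdjoint.energy_le {G : H →ₗ.[ℂ] H} (hG : IsPositiveSelfAdjoint G)
    (φ : G.domain) {E : ℝ} (hE : (⟪(φ : H), G φ⟫_ℂ).re ≤ E) :
    energy G φ ≤ ENNReal.ofReal E := by
  rw [hG.energy_le_iff ((hG.nonneg φ).trans hE)]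
  exact fun ε hε => ⟨φ, by simpa using hε, by linarith⟩

/-- Lagrange duality for the operator E-norm. -/
theorem IsPositiveSelfAdjoint.exists_dual {G : H →ₗ.[ℂ] H} (hG : IsPositiveSelfAdjoint G)
    (hG' : InfIsZero G) {E : ℝ} (hE : 0 < E) (A : H →L[ℂ] H) :
    ∃ l c : ℝ, 0 ≤ l ∧ 0 ≤ c ∧ l * E + c ≤ eNorm G E A ^ 2 ∧
      ∀ x : G.domain, ‖A x‖ ^ 2 ≤ l * (⟪(x : H), G x⟫_ℂ).re + c * ‖(x : H)‖ ^ 2 := by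
  set μ := eNorm G E A ^ 2 with hμ
  have hμ0 : 0 ≤ μ := sq_nonneg _
  -- By homogeneity the definition of the E-norm says that `G - E ≤ 0` at a vector forces `A*A - μ ≤
  -- 0` there; the S-lemma turns this into `A*A - μ ≤ l (G - E)`.
  set L : G.domain →ₗ[ℂ] H := G.toFun - (E : ℂ) • G.domain.subtype with hL
  set M : G.domain →ₗ[ℂ] H :=
    ((ContinuousLinearMap.adjoint A ∘L A : H →L[ℂ] H) : H →ₗ[ℂ] H) ∘ₗ G.domain.subtype -
      (μ : ℂ) • G.domain.subtype with hM
  have eL : ∀ x, quadForm L x = (⟪(x : H), G x⟫_ℂ).re - E * ‖(x : H)‖ ^ 2 := by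
    intro x
    change (⟪(x : H), G x - (E : ℂ) • (x : H)⟫_ℂ).re = _
    rw [inner_sub_right, inner_smul_right, Complex.sub_re, Complex.re_ofReal_mul, re_inner_self]
  have eM : ∀ x, quadForm M x = ‖A x‖ ^ 2 - μ * ‖(x : H)‖ ^ 2 := by
    intro x
    change (⟪(x : H), ContinuousLinearMap.adjoint A (A x) - (μ : ℂ) • (x : H)⟫_ℂ).re = _
    rw [inner_sub_right, inner_smul_right, Complex.sub_re, Complex.re_ofReal_mul, re_inner_self,
      ContinuousLinearMap.adjoint_inner_right, re_inner_self]
  have h : ∀ x, quadForm L x ≤ 0 → quadForm M x ≤ 0 := by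
    intro x hx
    rw [eM]
    rw [eL] at hx
    rcases (norm_nonneg (x : H)).eq_or_lt with h0 | h0
    · have : (x : H) = 0 := norm_eq_zero.1 h0.symm
      simp [this]
    set r : ℂ := ((‖(x : H)‖⁻¹ : ℝ) : ℂ) with hr
    have hn : ‖((r • x : G.domain) : H)‖ = 1 := by
      rw [Submodule.coe_smul, norm_smul, hr, Complex.norm_real, Real.norm_of_nonneg (by positivity)]
      field_simp
    have he : (⟪((r • x : G.domain) : H), G (r • x)⟫_ℂ).re ≤ E := by
      rw [Submodule.coe_smul, LinearPMap.map_smul, inner_smul_left, inner_smul_right, hr,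
        Complex.conj_ofReal, Complex.re_ofReal_mul, Complex.re_ofReal_mul, ← mul_assoc,
        ← mul_inv, inv_mul_le_iff₀ (by positivity)]
      linarith
    have := le_eNorm A hn (hG.energy_le _ he)
    rw [Submodule.coe_smul, map_smul, norm_smul, hr, Complex.norm_real,
      Real.norm_of_nonneg (by positivity), inv_mul_le_iff₀ h0] at this
    have := pow_le_pow_left₀ (norm_nonneg _) this 2
    rw [mul_pow] at this
    linarith
  obtain ⟨x₀, hx₀, hx₀'⟩ := hG'.exists_lt hE
  obtain ⟨l, hl, hle⟩ := exists_quadForm_le h (x₀ := x₀) (by rw [eL, hx₀]; linarith)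
  have key : ∀ x : G.domain,
      ‖A x‖ ^ 2 ≤ l * (⟪(x : H), G x⟫_ℂ).re + (μ - l * E) * ‖(x : H)‖ ^ 2 := by
    intro x
    have := hle x
    rw [eL, eM] at this
    linarith
  refine ⟨l, μ - l * E, hl, ?_, by linarith, key⟩
  -- Nonnegativity of `c = μ - l E` is read off unit vectors of energy close to `0`, where `0 ≤ ‖A
  -- y‖² ≤ l · (small) + c`.
  refine le_of_forall_pos_le_add fun ε hε => ?_
  obtain ⟨y, hy, hy'⟩ := hG'.exists_lt (ε := ε / (l + 1)) (by positivity)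
  have h1 := key y
  rw [hy] at h1
  have h2 : l * (⟪(y : H), G y⟫_ℂ).re ≤ ε := by
    calc l * (⟪(y : H), G y⟫_ℂ).re ≤ l * (ε / (l + 1)) := by gcongr
      _ = (l / (l + 1)) * ε := by ring
      _ ≤ 1 * ε := by gcongr; rw [div_le_one (by positivity)]; linarith
      _ = ε := one_mul ε
  nlinarith [sq_nonneg ‖A y‖]

end Duality

/-! ### Tensor products: positivity of forms, bounded operators and essential self-adjointness. -/

section Tensor

open scoped InnerProductSpace
open Topology TensorProduct

section Algebraic

/-- Every element of a tensor product can be expanded in an orthonormal system of the second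
factor. -/
theorem exists_orthonormal_expansion {M V : Type*} [AddCommGroup M] [Module ℂ M]
    [NormedAddCommGroup V] [InnerProductSpace ℂ V] (ω : M ⊗[ℂ] V) :
    ∃ (n : ℕ) (x : Fin n → M) (f : Fin n → V), Orthonormal ℂ f ∧ ω = ∑ i, x i ⊗ₜ[ℂ] f i := by
  obtain ⟨V', hV', hω⟩ := exists_finite_submodule_right_of_setFinite {ω} (Set.finite_singleton ω)
  obtain ⟨ω', rfl⟩ := Set.singleton_subset_iff.1 hω
  set e := stdOrthonormalBasis ℂ V'
  have key : ∃ x : Fin (Module.finrank ℂ V') → M, ω' = ∑ i, x i ⊗ₜ[ℂ] e i := by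
    clear hω
    induction ω' with
    | zero => exact ⟨0, by simp⟩
    | tmul a v =>
      refine ⟨fun i => e.repr v i • a, ?_⟩
      conv_lhs => rw [← e.sum_repr v, tmul_sum]
      simp [smul_tmul]
    | add a b ha hb =>
      obtain ⟨x, rfl⟩ := ha
      obtain ⟨y, rfl⟩ := hb
      exact ⟨x + y, by simp [add_tmul, Finset.sum_add_distrib]⟩
  obtain ⟨x, hx⟩ := key
  refine ⟨_, x, fun i => (e i : V), e.orthonormal.comp_linearIsometry V'.subtypeₗᵢ, ?_⟩
  rw [hx]
  simp

variable {H₁ H₂ : Type*} [NormedAddCommGroup H₁] [InnerProductSpace ℂ H₁]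
  [NormedAddCommGroup H₂] [InnerProductSpace ℂ H₂]
  {D₁ : Submodule ℂ H₁} {D₂ : Submodule ℂ H₂}

/-- The inclusion of the algebraic tensor product of two subspaces. -/
abbrev tensorIncl (D₁ : Submodule ℂ H₁) (D₂ : Submodule ℂ H₂) :
    D₁ ⊗[ℂ] D₂ →ₗ[ℂ] H₁ ⊗[ℂ] H₂ :=
  TensorProduct.map D₁.subtype D₂.subtype

/-- With `ω = ∑ xᵢ ⊗ fᵢ` and `fᵢ` orthonormal, the form equals `∑ quadForm L xᵢ`. -/
theorem re_inner_map_left_nonneg {L : D₁ →ₗ[ℂ] H₁} (hL : ∀ x, 0 ≤ quadForm L x)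
    (ω : D₁ ⊗[ℂ] D₂) :
    0 ≤ (⟪tensorIncl D₁ D₂ ω, TensorProduct.map L D₂.subtype ω⟫_ℂ).re := by
  classical
  obtain ⟨n, x, f, hf, rfl⟩ := exists_orthonormal_expansion ω
  have : ∀ i j, ⟪(f i : H₂), (f j : H₂)⟫_ℂ = if i = j then 1 else 0 :=
    fun i j => orthonormal_iff_ite.1 hf i j
  simp only [map_sum, TensorProduct.map_tmul, Submodule.subtype_apply, sum_inner, inner_sum,
    TensorProduct.inner_tmul, this, mul_ite, mul_one, mul_zero, Finset.sum_ite_eq',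
    Finset.mem_univ, if_true, Complex.re_sum]
  exact Finset.sum_nonneg fun i _ => hL _

theorem re_inner_map_right_nonneg {L : D₂ →ₗ[ℂ] H₂} (hL : ∀ x, 0 ≤ quadForm L x)
    (ω : D₁ ⊗[ℂ] D₂) :
    0 ≤ (⟪tensorIncl D₁ D₂ ω, TensorProduct.map D₁.subtype L ω⟫_ℂ).re := by
  have := re_inner_map_left_nonneg (D₂ := D₁) hL (TensorProduct.comm ℂ D₁ D₂ ω)
  rw [tensorIncl, TensorProduct.map_comm, TensorProduct.map_comm,
    TensorProduct.inner_comm_comm] at this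
  exact this

theorem inner_map_comm {L L' : D₁ →ₗ[ℂ] H₁} {M M' : D₂ →ₗ[ℂ] H₂}
    (hL : ∀ x y : D₁, ⟪L x, (y : H₁)⟫_ℂ = ⟪(x : H₁), L' y⟫_ℂ)
    (hM : ∀ x y : D₂, ⟪M x, (y : H₂)⟫_ℂ = ⟪(x : H₂), M' y⟫_ℂ) (ω η : D₁ ⊗[ℂ] D₂) :
    ⟪TensorProduct.map L M ω, tensorIncl D₁ D₂ η⟫_ℂ =
      ⟪tensorIncl D₁ D₂ ω, TensorProduct.map L' M' η⟫_ℂ := by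
  induction ω with
  | zero => simp
  | add a b ha hb => simp only [map_add, inner_add_left, ha, hb]
  | tmul x y =>
    induction η with
    | zero => simp
    | add a b ha hb => simp only [map_add, inner_add_right, ha, hb]
    | tmul x' y' => simp [hL, hM]

end Algebraic

variable {H₁ H₂ : Type*} [NormedAddCommGroup H₁] [InnerProductSpace ℂ H₁]
  [NormedAddCommGroup H₂] [InnerProductSpace ℂ H₂]

/-- The canonical embedding of the algebraic tensor product as a continuous linear map. -/
def toHilbert (H₁ H₂ : Type*) [NormedAddCommGroup H₁] [InnerProductSpace ℂ H₁]
    [NormedAddCommGroup H₂] [InnerProductSpace ℂ H₂] : H₁ ⊗[ℂ] H₂ →L[ℂ] HilbertTensor H₁ H₂ :=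
  UniformSpace.Completion.toComplL (𝕜 := ℂ) (E := H₁ ⊗[ℂ] H₂)

theorem denseRange_toHilbert : DenseRange (toHilbert H₁ H₂) :=
  UniformSpace.Completion.denseRange_coe

theorem continuous_toHilbert_tmul :
    Continuous fun p : H₁ × H₂ => toHilbert H₁ H₂ (p.1 ⊗ₜ p.2) :=
  (toHilbert H₁ H₂).continuous.comp TensorProduct.continuous_tmul

theorem inner_toHilbert (z w : H₁ ⊗[ℂ] H₂) : ⟪toHilbert H₁ H₂ z, toHilbert H₁ H₂ w⟫_ℂ = ⟪z, w⟫_ℂ :=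
  UniformSpace.Completion.inner_coe z w

theorem norm_toHilbert (z : H₁ ⊗[ℂ] H₂) : ‖toHilbert H₁ H₂ z‖ = ‖z‖ :=
  UniformSpace.Completion.norm_coe z

theorem tensorCLM_apply (A : H₁ →L[ℂ] H₁) (B : H₂ →L[ℂ] H₂) (z : H₁ ⊗[ℂ] H₂) :
    tensorCLM A B (toHilbert H₁ H₂ z) = toHilbert H₁ H₂ (TensorProduct.mapL A B z) :=
  ContinuousLinearMap.extend_eq _ denseRange_toHilbert
    (UniformSpace.Completion.isUniformInducing_coe _) z

theorem tensorCLM_tmul (A : H₁ →L[ℂ] H₁) (B : H₂ →L[ℂ] H₂) (x : H₁) (y : H₂) :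
    tensorCLM A B (toHilbert H₁ H₂ (x ⊗ₜ y)) = toHilbert H₁ H₂ (A x ⊗ₜ B y) := by
  rw [tensorCLM_apply]; rfl

theorem tensorCLM_ext {K K' : HilbertTensor H₁ H₂ →L[ℂ] HilbertTensor H₁ H₂}
    (h : ∀ x y, K (toHilbert H₁ H₂ (x ⊗ₜ y)) = K' (toHilbert H₁ H₂ (x ⊗ₜ y))) : K = K' := by
  have : K ∘L toHilbert H₁ H₂ = K' ∘L toHilbert H₁ H₂ := by
    apply ContinuousLinearMap.coe_injective
    exact TensorProduct.ext' h
  ext z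
  exact denseRange_toHilbert.induction_on z (isClosed_eq (by fun_prop) (by fun_prop))
    fun a => congr($this a)

theorem tensorCLM_comp (A A' : H₁ →L[ℂ] H₁) (B B' : H₂ →L[ℂ] H₂) :
    tensorCLM A B ∘L tensorCLM A' B' = tensorCLM (A ∘L A') (B ∘L B') :=
  tensorCLM_ext fun x y => by
    simp only [ContinuousLinearMap.comp_apply, tensorCLM_tmul]

theorem eq_zero_of_inner_tmul {s₁ : Set H₁} {s₂ : Set H₂} (h₁ : Dense s₁) (h₂ : Dense s₂)
    {w : HilbertTensor H₁ H₂}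
    (h : ∀ x ∈ s₁, ∀ y ∈ s₂, ⟪w, toHilbert H₁ H₂ (x ⊗ₜ y)⟫_ℂ = 0) : w = 0 := by
  have h' : ∀ x y, ⟪w, toHilbert H₁ H₂ (x ⊗ₜ y)⟫_ℂ = 0 := by
    intro x y
    have hcont : Continuous fun p : H₁ × H₂ => ⟪w, toHilbert H₁ H₂ (p.1 ⊗ₜ p.2)⟫_ℂ :=
      (innerSL ℂ w).continuous.comp continuous_toHilbert_tmul
    have heq : Set.EqOn (fun p : H₁ × H₂ => ⟪w, toHilbert H₁ H₂ (p.1 ⊗ₜ p.2)⟫_ℂ) (fun _ => 0)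
      (s₁ ×ˢ s₂) := fun p hp => h p.1 hp.1 p.2 hp.2
    exact congrFun (hcont.ext_on (h₁.prod h₂) continuous_const heq) (x, y)
  refine ext_inner_right ℂ fun v => ?_
  rw [inner_zero_left]
  refine denseRange_toHilbert.induction_on (p := fun v => ⟪w, v⟫_ℂ = 0) v
    (isClosed_eq (innerSL ℂ w).continuous continuous_const) fun z => ?_
  induction z with
  | zero => simp
  | add a b ha hb => rw [map_add, inner_add_right, ha, hb, add_zero]
  | tmul x y => exact h' x y

theorem dense_of_tmul_mem {M : Submodule ℂ (HilbertTensor H₁ H₂)}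
    {K : HilbertTensor H₁ H₂ →L[ℂ] HilbertTensor H₁ H₂} (hK : DenseRange K)
    (h : ∀ x y, K (toHilbert H₁ H₂ (x ⊗ₜ y)) ∈ M) : Dense (M : Set (HilbertTensor H₁ H₂)) := by
  have hd : DenseRange (K ∘ toHilbert H₁ H₂) := hK.comp denseRange_toHilbert K.continuous
  refine hd.mono ?_
  rintro _ ⟨z, rfl⟩
  change K (toHilbert H₁ H₂ z) ∈ M
  induction z with
  | zero => simp
  | add a b ha hb => rw [map_add, map_add]; exact M.add_mem ha hb
  | tmul x y => exact h x y

theorem norm_tensorCLM_id_left_le (B : H₂ →L[ℂ] H₂) (w : HilbertTensor H₁ H₂) :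
    ‖tensorCLM (ContinuousLinearMap.id ℂ H₁) B w‖ ≤ ‖B‖ * ‖w‖ := by
  refine denseRange_toHilbert.induction_on
    (p := fun w => ‖tensorCLM (ContinuousLinearMap.id ℂ H₁) B w‖ ≤ ‖B‖ * ‖w‖) w
    (isClosed_le (by fun_prop) (by fun_prop)) fun z => ?_
  rw [tensorCLM_apply, norm_toHilbert, norm_toHilbert]
  refine (ContinuousLinearMap.le_opNorm _ z).trans ?_
  gcongr
  refine (TensorProduct.norm_mapL_le _ _).trans ?_
  exact mul_le_of_le_one_left (norm_nonneg _) ContinuousLinearMap.norm_id_le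

theorem norm_tensorCLM_id_right_le (A : H₁ →L[ℂ] H₁) (w : HilbertTensor H₁ H₂) :
    ‖tensorCLM A (ContinuousLinearMap.id ℂ H₂) w‖ ≤ ‖A‖ * ‖w‖ := by
  refine denseRange_toHilbert.induction_on
    (p := fun w => ‖tensorCLM A (ContinuousLinearMap.id ℂ H₂) w‖ ≤ ‖A‖ * ‖w‖) w
    (isClosed_le (by fun_prop) (by fun_prop)) fun z => ?_
  rw [tensorCLM_apply, norm_toHilbert, norm_toHilbert]
  refine (ContinuousLinearMap.le_opNorm _ z).trans ?_
  gcongr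
  refine (TensorProduct.norm_mapL_le _ _).trans ?_
  exact mul_le_of_le_one_right (norm_nonneg _) ContinuousLinearMap.norm_id_le

section Adjoint

variable [CompleteSpace H₁] [CompleteSpace H₂]

theorem adjoint_tensorCLM (A : H₁ →L[ℂ] H₁) (B : H₂ →L[ℂ] H₂) :
    ContinuousLinearMap.adjoint (tensorCLM A B) =
      tensorCLM (ContinuousLinearMap.adjoint A) (ContinuousLinearMap.adjoint B) := by
  refine tensorCLM_ext fun x y => ?_
  refine sub_eq_zero.1 (eq_zero_of_inner_tmul dense_univ dense_univ fun x' _ y' _ => ?_)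
  rw [inner_sub_left, ContinuousLinearMap.adjoint_inner_left, tensorCLM_tmul, tensorCLM_tmul,
    inner_toHilbert, inner_toHilbert, TensorProduct.inner_tmul, TensorProduct.inner_tmul,
    ContinuousLinearMap.adjoint_inner_left, ContinuousLinearMap.adjoint_inner_left, sub_self]

theorem norm_tensorCLM_sq (A : H₁ →L[ℂ] H₁) (B : H₂ →L[ℂ] H₂) (w : HilbertTensor H₁ H₂) :
    ‖tensorCLM A B w‖ ^ 2 = (⟪w, tensorCLM (ContinuousLinearMap.adjoint A ∘L A)
      (ContinuousLinearMap.adjoint B ∘L B) w⟫_ℂ).re := by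
  rw [← tensorCLM_comp, ← adjoint_tensorCLM, ContinuousLinearMap.comp_apply,
    ContinuousLinearMap.adjoint_inner_right, re_inner_self]

/-- Factoring `A = P*P` and `B = Q*Q` makes the form equal to `‖(P ⊗ Q) w‖²`. -/
theorem re_inner_tensorCLM_nonneg {A : H₁ →L[ℂ] H₁} {B : H₂ →L[ℂ] H₂} (hA : 0 ≤ A) (hB : 0 ≤ B)
    (w : HilbertTensor H₁ H₂) : 0 ≤ (⟪w, tensorCLM A B w⟫_ℂ).re := by
  obtain ⟨P, rfl⟩ := CStarAlgebra.nonneg_iff_eq_star_mul_self.1 hA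
  obtain ⟨Q, rfl⟩ := CStarAlgebra.nonneg_iff_eq_star_mul_self.1 hB
  exact (norm_tensorCLM_sq P Q w).symm ▸ sq_nonneg _

theorem IsPositiveSelfAdjoint.exists_resolvent {H : Type*} [NormedAddCommGroup H]
    [InnerProductSpace ℂ H] [CompleteSpace H] {G : H →ₗ.[ℂ] H} (hG : IsPositiveSelfAdjoint G) :
    ∃ R : H →L[ℂ] H, 0 ≤ R ∧ R ≤ 1 ∧ (∀ x, R x = 0 → x = 0) ∧
      ∀ u, ∃ x : G.domain, (x : H) = R u ∧ G x = u - R u := by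
  obtain ⟨R, -, h0, h1, hi, hgr⟩ := hG.isPositiveCore.exists_resolvent
  refine ⟨R, h0, h1, hi, fun u => ?_⟩
  have := (hgr (R u) (u - R u)).2 (by rw [add_sub_cancel])
  rw [hG.closure_eq, LinearPMap.mem_graph_iff] at this
  exact this

/-- If `R₁` and `R₂` are the resolvents at `-1` of `G₁` and `G₂`, then the operator below is
`(R₁ ⊗ R₂) (1 + G₁ ⊗ I + I ⊗ G₂)`. -/
theorem denseRange_resolvent_sum {R₁ : H₁ →L[ℂ] H₁} {R₂ : H₂ →L[ℂ] H₂} (h₁ : 0 ≤ R₁)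
    (h₁' : R₁ ≤ 1) (hi₁ : ∀ x, R₁ x = 0 → x = 0) (h₂ : 0 ≤ R₂) :
    DenseRange (tensorCLM R₁ (ContinuousLinearMap.id ℂ H₂) + tensorCLM (1 - R₁) R₂ :
      HilbertTensor H₁ H₂ →L[ℂ] HilbertTensor H₁ H₂) := by
  set K := tensorCLM R₁ (ContinuousLinearMap.id ℂ H₂) + tensorCLM (1 - R₁) R₂ with hK
  have hp₁ := (ContinuousLinearMap.nonneg_iff_isPositive _).1 h₁
  have hp₁' := (ContinuousLinearMap.nonneg_iff_isPositive _).1 (sub_nonneg.2 h₁')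
  have hp₂ := (ContinuousLinearMap.nonneg_iff_isPositive _).1 h₂
  have hKa : ContinuousLinearMap.adjoint K = K := by
    rw [hK, map_add, adjoint_tensorCLM, adjoint_tensorCLM, hp₁.isSelfAdjoint.adjoint_eq,
      hp₁'.isSelfAdjoint.adjoint_eq, hp₂.isSelfAdjoint.adjoint_eq, ContinuousLinearMap.adjoint_id]
  -- Both summands of `K` are positive, so `K w = 0` makes each form vanish at `w`; then `(R₁ ⊗ I) w
  -- = 0`, and `R₁ ⊗ I` has dense range and is self-adjoint.
  have hker : ∀ w, K w = 0 → w = 0 := by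
    intro w hw
    have h3 := re_inner_tensorCLM_nonneg (sub_nonneg.2 h₁') h₂ w
    have h4 : (⟪w, K w⟫_ℂ).re = 0 := by rw [hw, inner_zero_right, Complex.zero_re]
    rw [hK, add_apply, inner_add_right, Complex.add_re] at h4
    obtain ⟨P, hP⟩ := CStarAlgebra.nonneg_iff_eq_star_mul_self.1 h₁
    have hR : tensorCLM R₁ (ContinuousLinearMap.id ℂ H₂) =
        ContinuousLinearMap.adjoint (tensorCLM P (ContinuousLinearMap.id ℂ H₂)) ∘L
          tensorCLM P (ContinuousLinearMap.id ℂ H₂) := by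
      rw [adjoint_tensorCLM, tensorCLM_comp, hP, ContinuousLinearMap.adjoint_id]
      rfl
    have h5 : tensorCLM P (ContinuousLinearMap.id ℂ H₂) w = 0 := by
      rw [hR, ContinuousLinearMap.comp_apply, ContinuousLinearMap.adjoint_inner_right,
        re_inner_self] at h4
      have : ‖tensorCLM P (ContinuousLinearMap.id ℂ H₂) w‖ ^ 2 = 0 :=
        le_antisymm (by linarith) (sq_nonneg _)
      simpa using this
    have h6 : tensorCLM R₁ (ContinuousLinearMap.id ℂ H₂) w = 0 := by
      rw [hR, ContinuousLinearMap.comp_apply, h5, map_zero]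
    have hd : DenseRange R₁ := by
      have : Dense ((LinearMap.range (R₁ : H₁ →ₗ[ℂ] H₁) : Submodule ℂ H₁) : Set H₁) := by
        rw [Submodule.dense_iff_topologicalClosure_eq_top,
          Submodule.topologicalClosure_eq_top_iff, eq_bot_iff]
        intro v hv
        refine hi₁ v (ext_inner_right ℂ fun u => ?_)
        rw [hp₁.inner_left_eq_inner_right, inner_zero_left]
        exact (Submodule.mem_orthogonal' _ _).1 hv _ ⟨u, rfl⟩
      exact this
    refine eq_zero_of_inner_tmul hd dense_univ ?_
    rintro _ ⟨x, rfl⟩ y -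
    have h7 : toHilbert H₁ H₂ (R₁ x ⊗ₜ y) =
        tensorCLM R₁ (ContinuousLinearMap.id ℂ H₂) (toHilbert H₁ H₂ (x ⊗ₜ y)) := by
      rw [tensorCLM_tmul]; rfl
    rw [h7, ← ContinuousLinearMap.adjoint_inner_left, adjoint_tensorCLM,
      hp₁.isSelfAdjoint.adjoint_eq, ContinuousLinearMap.adjoint_id, h6, inner_zero_left]
  have : Dense ((LinearMap.range (K : HilbertTensor H₁ H₂ →ₗ[ℂ] HilbertTensor H₁ H₂) :
      Submodule ℂ (HilbertTensor H₁ H₂)) : Set (HilbertTensor H₁ H₂)) := by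
    rw [Submodule.dense_iff_topologicalClosure_eq_top,
      Submodule.topologicalClosure_eq_top_iff, eq_bot_iff]
    intro v hv
    refine hker v (ext_inner_right ℂ fun u => ?_)
    rw [← hKa, ContinuousLinearMap.adjoint_inner_left, inner_zero_left]
    exact (Submodule.mem_orthogonal' _ _).1 hv _ ⟨u, rfl⟩
  exact this

end Adjoint

section PMap

variable {D₁ : Submodule ℂ H₁} {D₂ : Submodule ℂ H₂} {L : D₁ ⊗[ℂ] D₂ →ₗ[ℂ] H₁ ⊗[ℂ] H₂}

/-- An element of the algebraic tensor product as an element of the domain of `tensorPMap`. -/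
def tensorPMapMk (L : D₁ ⊗[ℂ] D₂ →ₗ[ℂ] H₁ ⊗[ℂ] H₂) (ω : D₁ ⊗[ℂ] D₂) :
    (tensorPMap D₁ D₂ L).domain :=
  ⟨tensorEmbed D₁ D₂ ω, ω, rfl⟩

theorem coe_tensorPMapMk (ω : D₁ ⊗[ℂ] D₂) :
    (tensorPMapMk L ω : HilbertTensor H₁ H₂) = toHilbert H₁ H₂ (tensorIncl D₁ D₂ ω) := rfl

theorem tensorPMap_apply_mk (ω : D₁ ⊗[ℂ] D₂) :
    tensorPMap D₁ D₂ L (tensorPMapMk L ω) = toHilbert H₁ H₂ (L ω) := by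
  have : (LinearEquiv.ofInjective (tensorEmbed D₁ D₂) (tensorEmbed_injective D₁ D₂)).symm
      ⟨tensorEmbed D₁ D₂ ω, ω, rfl⟩ = ω := by
    rw [LinearEquiv.symm_apply_eq]; rfl
  exact congrArg (fun z => toHilbert H₁ H₂ (L z)) this

theorem tensorPMapMk_surjective : Function.Surjective (tensorPMapMk L) := by
  rintro ⟨_, ω, rfl⟩
  exact ⟨ω, rfl⟩

theorem re_inner_tensorPMap (ω : D₁ ⊗[ℂ] D₂) :
    (⟪(tensorPMapMk L ω : HilbertTensor H₁ H₂), tensorPMap D₁ D₂ L (tensorPMapMk L ω)⟫_ℂ).re =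
      (⟪tensorIncl D₁ D₂ ω, L ω⟫_ℂ).re := by
  rw [tensorPMap_apply_mk, coe_tensorPMapMk, inner_toHilbert]

/-- The operator `K` certifies that `1 + L` has dense range: its values on product vectors, which
span a dense subspace, all lie in that range. -/
theorem isPositiveCore_tensorPMap (h₁ : Dense (D₁ : Set H₁)) (h₂ : Dense (D₂ : Set H₂))
    (hsymm : ∀ ω η, ⟪L ω, tensorIncl D₁ D₂ η⟫_ℂ = ⟪tensorIncl D₁ D₂ ω, L η⟫_ℂ)
    (hnonneg : ∀ ω, 0 ≤ (⟪tensorIncl D₁ D₂ ω, L ω⟫_ℂ).re)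
    {K : HilbertTensor H₁ H₂ →L[ℂ] HilbertTensor H₁ H₂} (hK : DenseRange K)
    (hrange : ∀ x y, ∃ ω, K (toHilbert H₁ H₂ (x ⊗ₜ y)) =
      toHilbert H₁ H₂ (tensorIncl D₁ D₂ ω + L ω)) :
    IsPositiveCore (tensorPMap D₁ D₂ L) where
  dense_domain := by
    rw [Submodule.dense_iff_topologicalClosure_eq_top,
      Submodule.topologicalClosure_eq_top_iff, eq_bot_iff]
    intro w hw
    refine eq_zero_of_inner_tmul h₁ h₂ fun x hx y hy => ?_
    exact (Submodule.mem_orthogonal' _ _).1 hw _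
      (tensorPMapMk L ((⟨x, hx⟩ : D₁) ⊗ₜ[ℂ] (⟨y, hy⟩ : D₂))).2
  symm := by
    intro χ χ'
    obtain ⟨ω, rfl⟩ := tensorPMapMk_surjective χ
    obtain ⟨η, rfl⟩ := tensorPMapMk_surjective χ'
    rw [tensorPMap_apply_mk, tensorPMap_apply_mk, coe_tensorPMapMk, coe_tensorPMapMk,
      inner_toHilbert, inner_toHilbert, hsymm]
  nonneg := by
    intro χ
    obtain ⟨ω, rfl⟩ := tensorPMapMk_surjective χ
    rw [re_inner_tensorPMap]
    exact hnonneg ω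
  dense_range := by
    have : Dense ((LinearMap.range ((tensorPMap D₁ D₂ L).domain.subtype +
        (tensorPMap D₁ D₂ L).toFun) : Submodule ℂ (HilbertTensor H₁ H₂)) :
          Set (HilbertTensor H₁ H₂)) := by
      refine dense_of_tmul_mem hK fun x y => ?_
      obtain ⟨ω, hω⟩ := hrange x y
      refine ⟨tensorPMapMk L ω, ?_⟩
      change (tensorPMapMk L ω : HilbertTensor H₁ H₂) + tensorPMap D₁ D₂ L (tensorPMapMk L ω) = _
      rw [tensorPMap_apply_mk, coe_tensorPMapMk, hω, map_add]
    exact this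

variable [CompleteSpace H₁] {G₁ : H₁ →ₗ.[ℂ] H₁} {G₂ : H₂ →ₗ.[ℂ] H₂}

variable (H₂) in
theorem isPositiveCore_tensorId (hG₁ : IsPositiveSelfAdjoint G₁) :
    IsPositiveCore (tensorPMap G₁.domain (⊤ : Submodule ℂ H₂)
      (TensorProduct.map G₁.toFun (⊤ : Submodule ℂ H₂).subtype)) := by
  obtain ⟨R, h0, h1, hi, hR⟩ := hG₁.exists_resolvent
  refine isPositiveCore_tensorPMap hG₁.dense_domain (by simp)
    (inner_map_comm hG₁.isFormalAdjoint fun _ _ => rfl)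
    (re_inner_map_left_nonneg hG₁.nonneg)
    (K := ContinuousLinearMap.id ℂ _) Function.surjective_id.denseRange fun u v => ?_
  obtain ⟨x, hx, hx'⟩ := hR u
  -- `(1 + G₁ ⊗ I)(R u ⊗ v) = u ⊗ v`, so `K` can be the identity.
  refine ⟨x ⊗ₜ ⟨v, Submodule.mem_top⟩, ?_⟩
  rw [TensorProduct.map_tmul, TensorProduct.map_tmul, ← TensorProduct.add_tmul,
    LinearPMap.toFun_eq_coe, hx', Submodule.subtype_apply, hx, add_sub_cancel]
  rfl

theorem isPositiveCore_tensorSum [CompleteSpace H₂] (hG₁ : IsPositiveSelfAdjoint G₁)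
    (hG₂ : IsPositiveSelfAdjoint G₂) :
    IsPositiveCore (tensorPMap G₁.domain G₂.domain
      (TensorProduct.map G₁.toFun G₂.domain.subtype +
        TensorProduct.map G₁.domain.subtype G₂.toFun)) := by
  obtain ⟨R, h0, h1, hi, hR⟩ := hG₁.exists_resolvent
  obtain ⟨R', h0', -, -, hR'⟩ := hG₂.exists_resolvent
  refine isPositiveCore_tensorPMap hG₁.dense_domain hG₂.dense_domain (fun ω η => ?_) (fun ω => ?_)
    (denseRange_resolvent_sum h0 h1 hi h0') fun u v => ?_
  · rw [LinearMap.add_apply, LinearMap.add_apply, inner_add_left, inner_add_right,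
      inner_map_comm (M' := G₂.domain.subtype) hG₁.isFormalAdjoint fun _ _ => rfl,
      inner_map_comm (L' := G₁.domain.subtype) (fun _ _ => rfl) hG₂.isFormalAdjoint]
  · rw [LinearMap.add_apply, inner_add_right, Complex.add_re]
    exact add_nonneg (re_inner_map_left_nonneg hG₁.nonneg ω)
      (re_inner_map_right_nonneg hG₂.nonneg ω)
  · obtain ⟨x, hx, hx'⟩ := hR u
    obtain ⟨y, hy, hy'⟩ := hR' v
    -- On `R u ⊗ R' v` the operator `1 + G₁ ⊗ I + I ⊗ G₂` gives `R u ⊗ v + (1 - R) u ⊗ R' v`.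
    refine ⟨x ⊗ₜ y, ?_⟩
    rw [add_apply, tensorCLM_tmul, tensorCLM_tmul, ← map_add]
    congr 1
    simp only [LinearMap.add_apply, TensorProduct.map_tmul, LinearPMap.toFun_eq_coe, hx', hy',
      Submodule.subtype_apply, hx, hy, ContinuousLinearMap.id_apply, sub_apply,
      one_apply_eq_self, TensorProduct.sub_tmul, TensorProduct.tmul_sub]
    abel

end PMap

end Tensor

/-! ### Energies on the tensor product and the E-norm estimates. -/

section Main

open scoped InnerProductSpace
open Topology TensorProduct Filter

theorem tensorMap_sub_left {M N P Q : Type*} [AddCommGroup M] [AddCommGroup N] [AddCommGroup P]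
    [AddCommGroup Q] [Module ℂ M] [Module ℂ N] [Module ℂ P] [Module ℂ Q]
    (f f' : M →ₗ[ℂ] P) (g : N →ₗ[ℂ] Q) :
    TensorProduct.map (f - f') g = TensorProduct.map f g - TensorProduct.map f' g :=
  TensorProduct.ext' fun _ _ => by simp [TensorProduct.sub_tmul]

theorem tensorMap_sub_right {M N P Q : Type*} [AddCommGroup M] [AddCommGroup N] [AddCommGroup P]
    [AddCommGroup Q] [Module ℂ M] [Module ℂ N] [Module ℂ P] [Module ℂ Q]
    (f : M →ₗ[ℂ] P) (g g' : N →ₗ[ℂ] Q) :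
    TensorProduct.map f (g - g') = TensorProduct.map f g - TensorProduct.map f g' :=
  TensorProduct.ext' fun _ _ => by simp [TensorProduct.tmul_sub]

variable {H₁ H₂ : Type*} [NormedAddCommGroup H₁] [InnerProductSpace ℂ H₁]
  [NormedAddCommGroup H₂] [InnerProductSpace ℂ H₂]

theorem norm_toHilbert_tmul (x : H₁) (y : H₂) : ‖toHilbert H₁ H₂ (x ⊗ₜ y)‖ = ‖x‖ * ‖y‖ := by
  rw [norm_toHilbert, TensorProduct.norm_tmul]

theorem tendsto_toHilbert_tmul {ι : Type*} {l : Filter ι} {u : ι → H₁} {v : ι → H₂} {x : H₁}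
    {y : H₂} (hu : Tendsto u l (𝓝 x)) (hv : Tendsto v l (𝓝 y)) :
    Tendsto (fun i => toHilbert H₁ H₂ (u i ⊗ₜ v i)) l (𝓝 (toHilbert H₁ H₂ (x ⊗ₜ y))) :=
  Tendsto.comp (f := fun i => (u i, v i)) (g := fun p : H₁ × H₂ => toHilbert H₁ H₂ (p.1 ⊗ₜ p.2))
    (y := 𝓝 (x, y)) (Continuous.tendsto continuous_toHilbert_tmul (x, y)) (hu.prodMk_nhds hv)

theorem quadForm_dual {H : Type*} [NormedAddCommGroup H] [InnerProductSpace ℂ H] [CompleteSpace H]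
    (G : H →ₗ.[ℂ] H) (A : H →L[ℂ] H) (l c : ℝ) (x : G.domain) :
    quadForm ((l : ℂ) • G.toFun + (c : ℂ) • G.domain.subtype -
      ((ContinuousLinearMap.adjoint A ∘L A : H →L[ℂ] H) : H →ₗ[ℂ] H) ∘ₗ G.domain.subtype) x =
      l * (⟪(x : H), G x⟫_ℂ).re + c * ‖(x : H)‖ ^ 2 - ‖A x‖ ^ 2 := by
  change (⟪(x : H), (l : ℂ) • G x + (c : ℂ) • (x : H) -
    ContinuousLinearMap.adjoint A (A x)⟫_ℂ).re = _
  rw [inner_sub_right, inner_add_right, inner_smul_right, inner_smul_right, Complex.sub_re,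
    Complex.add_re, Complex.re_ofReal_mul, Complex.re_ofReal_mul, re_inner_self,
    ContinuousLinearMap.adjoint_inner_right, re_inner_self]

theorem re_inner_tensorSum_tmul (G₁ : H₁ →ₗ.[ℂ] H₁) (G₂ : H₂ →ₗ.[ℂ] H₂) (χ : G₁.domain)
    (ξ : G₂.domain) :
    (⟪tensorIncl G₁.domain G₂.domain (χ ⊗ₜ ξ),
      (TensorProduct.map G₁.toFun G₂.domain.subtype +
        TensorProduct.map G₁.domain.subtype G₂.toFun) (χ ⊗ₜ ξ)⟫_ℂ).re =
      (⟪(χ : H₁), G₁ χ⟫_ℂ).re * ‖(ξ : H₂)‖ ^ 2 + ‖(χ : H₁)‖ ^ 2 * (⟪(ξ : H₂), G₂ ξ⟫_ℂ).re := by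
  rw [LinearMap.add_apply, TensorProduct.map_tmul, TensorProduct.map_tmul,
    TensorProduct.map_tmul, inner_add_right, TensorProduct.inner_tmul, TensorProduct.inner_tmul,
    Complex.add_re]
  simp only [Submodule.subtype_apply, LinearPMap.toFun_eq_coe]
  rw [inner_self_eq_norm_sq_to_K, inner_self_eq_norm_sq_to_K]
  simp [← Complex.ofReal_pow]

variable [CompleteSpace H₁] {G₁ : H₁ →ₗ.[ℂ] H₁} {G₂ : H₂ →ₗ.[ℂ] H₂}

theorem energy_tensorId_tmul_le (hG₁ : IsPositiveSelfAdjoint G₁)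
    {x : ℝ} (hx : 0 ≤ x) {φ : H₁} {ψ : H₂} (hψ : ‖ψ‖ = 1)
    (h₁ : energy G₁ φ ≤ ENNReal.ofReal x) :
    energy (opTensorId H₂ G₁) (toHilbert H₁ H₂ (φ ⊗ₜ ψ)) ≤ ENNReal.ofReal x := by
  rw [opTensorId, (isPositiveCore_tensorId H₂ hG₁).energy_le_iff hx]
  rw [hG₁.energy_le_iff hx] at h₁
  intro ε hε
  obtain ⟨χ, h1, h2⟩ := h₁ ε hε
  refine ⟨tensorPMapMk _ (χ ⊗ₜ ⟨ψ, Submodule.mem_top⟩), ?_, ?_⟩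
  · have : (tensorPMapMk (TensorProduct.map G₁.toFun (⊤ : Submodule ℂ H₂).subtype)
        (χ ⊗ₜ ⟨ψ, Submodule.mem_top⟩) : HilbertTensor H₁ H₂) - toHilbert H₁ H₂ (φ ⊗ₜ ψ) =
        toHilbert H₁ H₂ (((χ : H₁) - φ) ⊗ₜ ψ) := by
      rw [TensorProduct.sub_tmul, map_sub]; rfl
    rw [this, norm_toHilbert_tmul, hψ, mul_one]
    exact h1
  · rw [re_inner_tensorPMap, TensorProduct.map_tmul, TensorProduct.map_tmul,
      TensorProduct.inner_tmul]
    simp only [Submodule.subtype_apply, LinearPMap.toFun_eq_coe]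
    rw [inner_self_eq_norm_sq_to_K, hψ]
    simpa using h2

variable [CompleteSpace H₂]

/-- The form of `l G₁ + c - A*A` is nonnegative, hence remains so after tensoring with the identity.
-/
theorem norm_tensorCLM_left_sq_le {D₂ : Submodule ℂ H₂} {A : H₁ →L[ℂ] H₁} {l c : ℝ}
    (h : ∀ x : G₁.domain, ‖A x‖ ^ 2 ≤ l * (⟪(x : H₁), G₁ x⟫_ℂ).re + c * ‖(x : H₁)‖ ^ 2)
    (ω : G₁.domain ⊗[ℂ] D₂) :
    ‖tensorCLM A (ContinuousLinearMap.id ℂ H₂) (toHilbert H₁ H₂ (tensorIncl _ _ ω))‖ ^ 2 ≤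
      l * (⟪tensorIncl _ _ ω, TensorProduct.map G₁.toFun D₂.subtype ω⟫_ℂ).re +
        c * ‖toHilbert H₁ H₂ (tensorIncl _ _ ω)‖ ^ 2 := by
  have hpos := re_inner_map_left_nonneg (fun x => (quadForm_dual G₁ A l c x).symm ▸
    sub_nonneg.2 (h x)) ω
  have hself := re_inner_self (tensorIncl G₁.domain D₂ ω)
  have hmap : TensorProduct.map (((ContinuousLinearMap.adjoint A ∘L A : H₁ →L[ℂ] H₁) :
      H₁ →ₗ[ℂ] H₁) ∘ₗ G₁.domain.subtype) D₂.subtype ω =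
      TensorProduct.mapL (ContinuousLinearMap.adjoint A ∘L A) (ContinuousLinearMap.id ℂ H₂)
        (tensorIncl _ _ ω) := by
    rw [TensorProduct.mapL_apply, tensorIncl, TensorProduct.map_map]; rfl
  rw [tensorMap_sub_left, TensorProduct.map_add_left, TensorProduct.map_smul_left,
    TensorProduct.map_smul_left, LinearMap.sub_apply, LinearMap.add_apply, LinearMap.smul_apply,
    LinearMap.smul_apply, hmap, inner_sub_right, inner_add_right, inner_smul_right,
    inner_smul_right, Complex.sub_re, Complex.add_re, Complex.re_ofReal_mul,
    Complex.re_ofReal_mul, hself] at hpos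
  rw [norm_tensorCLM_sq, ContinuousLinearMap.adjoint_id, ContinuousLinearMap.id_comp,
    tensorCLM_apply, inner_toHilbert, norm_toHilbert]
  linarith

theorem norm_tensorCLM_right_sq_le {D₁ : Submodule ℂ H₁} {B : H₂ →L[ℂ] H₂} {l c : ℝ}
    (h : ∀ x : G₂.domain, ‖B x‖ ^ 2 ≤ l * (⟪(x : H₂), G₂ x⟫_ℂ).re + c * ‖(x : H₂)‖ ^ 2)
    (ω : D₁ ⊗[ℂ] G₂.domain) :
    ‖tensorCLM (ContinuousLinearMap.id ℂ H₁) B (toHilbert H₁ H₂ (tensorIncl _ _ ω))‖ ^ 2 ≤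
      l * (⟪tensorIncl _ _ ω, TensorProduct.map D₁.subtype G₂.toFun ω⟫_ℂ).re +
        c * ‖toHilbert H₁ H₂ (tensorIncl _ _ ω)‖ ^ 2 := by
  have hpos := re_inner_map_right_nonneg (fun x => (quadForm_dual G₂ B l c x).symm ▸
    sub_nonneg.2 (h x)) ω
  have hself := re_inner_self (tensorIncl D₁ G₂.domain ω)
  have hmap : TensorProduct.map D₁.subtype (((ContinuousLinearMap.adjoint B ∘L B : H₂ →L[ℂ] H₂) :
      H₂ →ₗ[ℂ] H₂) ∘ₗ G₂.domain.subtype) ω =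
      TensorProduct.mapL (ContinuousLinearMap.id ℂ H₁) (ContinuousLinearMap.adjoint B ∘L B)
        (tensorIncl _ _ ω) := by
    rw [TensorProduct.mapL_apply, tensorIncl, TensorProduct.map_map]; rfl
  rw [tensorMap_sub_right, TensorProduct.map_add_right, TensorProduct.map_smul_right,
    TensorProduct.map_smul_right, LinearMap.sub_apply, LinearMap.add_apply, LinearMap.smul_apply,
    LinearMap.smul_apply, hmap, inner_sub_right, inner_add_right, inner_smul_right,
    inner_smul_right, Complex.sub_re, Complex.add_re, Complex.re_ofReal_mul,
    Complex.re_ofReal_mul, hself] at hpos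
  rw [norm_tensorCLM_sq, ContinuousLinearMap.adjoint_id, ContinuousLinearMap.id_comp,
    tensorCLM_apply, inner_toHilbert, norm_toHilbert]
  linarith

/-- If `N` is bounded by an affine function of the energy `α` for every dual pair `(l, c)`, then
`N` is bounded by the E-norm, up to rescaling of the energy. -/
theorem IsPositiveSelfAdjoint.mul_le_eNorm_sq {H : Type*} [NormedAddCommGroup H]
    [InnerProductSpace ℂ H] [CompleteSpace H] {G : H →ₗ.[ℂ] H} (hG : IsPositiveSelfAdjoint G)
    (hG' : InfIsZero G) {A : H →L[ℂ] H} {α N : ℝ}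
    (h : ∀ l c : ℝ, (∀ x : G.domain,
      ‖A x‖ ^ 2 ≤ l * (⟪(x : H), G x⟫_ℂ).re + c * ‖(x : H)‖ ^ 2) → N ≤ l * α + c)
    {t x : ℝ} (hx : 0 < x) (ht : 0 ≤ t) (ht1 : t ≤ 1) (htx : t * α ≤ x) :
    t * N ≤ eNorm G x A ^ 2 := by
  obtain ⟨l, c, hl, hc, hle, hd⟩ := hG.exists_dual hG' hx A
  calc t * N ≤ t * (l * α + c) := by gcongr; exact h l c hd
    _ = l * (t * α) + t * c := by ring
    -- Here `l ≥ 0` is used with `t α ≤ x`, and `c ≥ 0` with `t ≤ 1`.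
    _ ≤ l * x + 1 * c := by gcongr
    _ ≤ _ := by rw [one_mul]; exact hle

theorem IsPositiveSelfAdjoint.norm_sq_le_of_energy_le {H : Type*} [NormedAddCommGroup H]
    [InnerProductSpace ℂ H] [CompleteSpace H] {G : H →ₗ.[ℂ] H} (hG : IsPositiveSelfAdjoint G)
    {A : H →L[ℂ] H} {φ : H} {E : ℝ} (hE : 0 ≤ E) (hφ : ‖φ‖ = 1)
    (he : energy G φ ≤ ENNReal.ofReal E) {l c : ℝ} (hl : 0 ≤ l) (h : ∀ x : G.domain,
      ‖A x‖ ^ 2 ≤ l * (⟪(x : H), G x⟫_ℂ).re + c * ‖(x : H)‖ ^ 2) :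
    ‖A φ‖ ^ 2 ≤ l * E + c := by
  rw [hG.energy_le_iff hE] at he
  choose χ h1 h2 using fun n : ℕ => he (1 / ((n : ℝ) + 1)) (by positivity)
  have hχ : Tendsto (fun n => (χ n : H)) atTop (𝓝 φ) := by
    rw [tendsto_iff_norm_sub_tendsto_zero]
    exact squeeze_zero (fun _ => norm_nonneg _) (fun n => (h1 n).le)
      tendsto_one_div_add_atTop_nhds_zero_nat
  have hl1 : Tendsto (fun n => ‖A (χ n)‖ ^ 2) atTop (𝓝 (‖A φ‖ ^ 2)) :=
    ((A.continuous.tendsto φ).comp hχ).norm.pow 2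
  have hl2 : Tendsto (fun n : ℕ => l * (E + 1 / ((n : ℝ) + 1)) + c * ‖(χ n : H)‖ ^ 2) atTop
      (𝓝 (l * (E + 0) + c * ‖φ‖ ^ 2)) :=
    (tendsto_const_nhds.mul (tendsto_const_nhds.add
      tendsto_one_div_add_atTop_nhds_zero_nat)).add (tendsto_const_nhds.mul (hχ.norm.pow 2))
  have := le_of_tendsto_of_tendsto' hl1 hl2 fun n => (h (χ n)).trans (by gcongr; exact (h2 n).le)
  rwa [hφ, add_zero, one_pow, mul_one] at this

/-- A weak form of the concavity of `E ↦ ‖A‖_E ^ 2`. -/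
theorem IsPositiveSelfAdjoint.mul_eNorm_sq_le {H : Type*} [NormedAddCommGroup H]
    [InnerProductSpace ℂ H] [CompleteSpace H] {G : H →ₗ.[ℂ] H} (hG : IsPositiveSelfAdjoint G)
    (hG' : InfIsZero G) (A : H →L[ℂ] H) {E t : ℝ} (hE : 0 < E) (ht : 0 < t) (ht1 : t ≤ 1) :
    t * eNorm G E A ^ 2 ≤ eNorm G (t * E) A ^ 2 := by
  -- A dual pair taken at the smaller energy `t E` still bounds the norm at energy `E`.
  obtain ⟨l, c, hl, hc, hle, hd⟩ := hG.exists_dual hG' (mul_pos ht hE) A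
  have hb : eNorm G E A ≤ √(l * E + c) := eNorm_le (Real.sqrt_nonneg _) fun φ h1 h2 =>
    Real.le_sqrt_of_sq_le (hG.norm_sq_le_of_energy_le hE.le h1 h2 hl hd)
  have hb2 : eNorm G E A ^ 2 ≤ l * E + c :=
    (pow_le_pow_left₀ (eNorm_nonneg _ _ _) hb 2).trans_eq (Real.sq_sqrt (by positivity))
  calc t * eNorm G E A ^ 2 ≤ t * (l * E + c) := by gcongr
    _ = l * (t * E) + t * c := by ring
    _ ≤ l * (t * E) + 1 * c := by gcongr
    _ ≤ _ := by rw [one_mul]; exact hle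

/-- The energy of a state with respect to `G₁ ⊗ I + I ⊗ G₂` splits into energies of its parts. -/
theorem exists_energy_split (hG₁ : IsPositiveSelfAdjoint G₁) (hG₂ : IsPositiveSelfAdjoint G₂)
    {E : ℝ} (hE : 0 ≤ E) {w : HilbertTensor H₁ H₂} (hw : ‖w‖ = 1)
    (he : energy (opTensorSum G₁ G₂) w ≤ ENNReal.ofReal E) :
    ∃ α β : ℝ, 0 ≤ α ∧ 0 ≤ β ∧ α + β ≤ E ∧
      (∀ (A : H₁ →L[ℂ] H₁) (l c : ℝ), (∀ x : G₁.domain,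
        ‖A x‖ ^ 2 ≤ l * (⟪(x : H₁), G₁ x⟫_ℂ).re + c * ‖(x : H₁)‖ ^ 2) →
          ‖tensorCLM A (ContinuousLinearMap.id ℂ H₂) w‖ ^ 2 ≤ l * α + c) ∧
      (∀ (B : H₂ →L[ℂ] H₂) (l c : ℝ), (∀ x : G₂.domain,
        ‖B x‖ ^ 2 ≤ l * (⟪(x : H₂), G₂ x⟫_ℂ).re + c * ‖(x : H₂)‖ ^ 2) →
          ‖tensorCLM (ContinuousLinearMap.id ℂ H₁) B w‖ ^ 2 ≤ l * β + c) := by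
  rw [opTensorSum, (isPositiveCore_tensorSum hG₁ hG₂).energy_le_iff hE] at he
  have he' : ∀ n : ℕ, ∃ ω : G₁.domain ⊗[ℂ] G₂.domain,
      ‖toHilbert H₁ H₂ (tensorIncl _ _ ω) - w‖ < 1 / ((n : ℝ) + 1) ∧
      (⟪tensorIncl _ _ ω, TensorProduct.map G₁.toFun G₂.domain.subtype ω⟫_ℂ).re +
        (⟪tensorIncl _ _ ω, TensorProduct.map G₁.domain.subtype G₂.toFun ω⟫_ℂ).re <
          E + 1 / ((n : ℝ) + 1) := by
    intro n
    obtain ⟨χ, h1, h2⟩ := he (1 / ((n : ℝ) + 1)) (by positivity)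
    obtain ⟨ω, rfl⟩ := tensorPMapMk_surjective χ
    rw [re_inner_tensorPMap, LinearMap.add_apply, inner_add_right, Complex.add_re] at h2
    exact ⟨ω, h1, h2⟩
  choose ω h1 h2 using he'
  set a : ℕ → ℝ := fun n =>
    (⟪tensorIncl _ _ (ω n), TensorProduct.map G₁.toFun G₂.domain.subtype (ω n)⟫_ℂ).re with ha
  set b : ℕ → ℝ := fun n =>
    (⟪tensorIncl _ _ (ω n), TensorProduct.map G₁.domain.subtype G₂.toFun (ω n)⟫_ℂ).re with hb
  have ha0 : ∀ n, 0 ≤ a n := fun n => re_inner_map_left_nonneg hG₁.nonneg (ω n)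
  have hb0 : ∀ n, 0 ≤ b n := fun n => re_inner_map_right_nonneg hG₂.nonneg (ω n)
  have hab : ∀ n, a n + b n < E + 1 / ((n : ℝ) + 1) := h2
  have hab1 : ∀ n, a n + b n ≤ E + 1 := fun n => by
    refine (hab n).le.trans ?_
    gcongr
    rw [div_le_one (by positivity)]
    have : (0 : ℝ) ≤ n := Nat.cast_nonneg n
    linarith
  have hmem : ∀ n, (a n, b n) ∈ Set.Icc (0 : ℝ) (E + 1) ×ˢ Set.Icc (0 : ℝ) (E + 1) := fun n =>
    ⟨⟨ha0 n, by linarith [hab1 n, hb0 n]⟩, ⟨hb0 n, by linarith [hab1 n, ha0 n]⟩⟩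
  -- The two partial energies of the approximants need not converge, but are bounded; `α` and `β`
  -- are limits along a common subsequence.
  obtain ⟨⟨α, β⟩, -, s, hs, hlim⟩ := (isCompact_Icc.prod isCompact_Icc).tendsto_subseq hmem
  have hα : Tendsto (fun n => a (s n)) atTop (𝓝 α) := (continuous_fst.tendsto _).comp hlim
  have hβ : Tendsto (fun n => b (s n)) atTop (𝓝 β) := (continuous_snd.tendsto _).comp hlim
  have hinv : Tendsto (fun n : ℕ => 1 / ((s n : ℝ) + 1)) atTop (𝓝 0) :=
    tendsto_one_div_add_atTop_nhds_zero_nat.comp hs.tendsto_atTop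
  have hw' : Tendsto (fun n => toHilbert H₁ H₂ (tensorIncl _ _ (ω (s n)))) atTop (𝓝 w) := by
    rw [tendsto_iff_norm_sub_tendsto_zero]
    exact squeeze_zero (fun _ => norm_nonneg _) (fun n => (h1 (s n)).le) hinv
  have hn := hw'.norm.pow 2
  rw [hw, one_pow] at hn
  refine ⟨α, β, ge_of_tendsto' hα fun n => ha0 _, ge_of_tendsto' hβ fun n => hb0 _, ?_,
    fun A l c h => ?_, fun B l c h => ?_⟩
  · have := le_of_tendsto_of_tendsto' (hα.add hβ) (tendsto_const_nhds.add hinv)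
      fun n => (hab (s n)).le
    rwa [add_zero] at this
  · have hl := (((tensorCLM A (ContinuousLinearMap.id ℂ H₂)).continuous.tendsto w).comp
      hw').norm.pow 2
    have := le_of_tendsto_of_tendsto' hl ((hα.const_mul l).add (hn.const_mul c))
      fun n => norm_tensorCLM_left_sq_le h (ω (s n))
    rwa [mul_one] at this
  · have hl := (((tensorCLM (ContinuousLinearMap.id ℂ H₁) B).continuous.tendsto w).comp
      hw').norm.pow 2
    have := le_of_tendsto_of_tendsto' hl ((hβ.const_mul l).add (hn.const_mul c))
      fun n => norm_tensorCLM_right_sq_le h (ω (s n))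
    rwa [mul_one] at this

theorem norm_tensorCLM_le_of_energy_tensorId_le (hG₁ : IsPositiveSelfAdjoint G₁)
    (hG₁' : InfIsZero G₁) {E : ℝ} (hE : 0 < E) (A : H₁ →L[ℂ] H₁) {w : HilbertTensor H₁ H₂}
    (hw : ‖w‖ = 1) (he : energy (opTensorId H₂ G₁) w ≤ ENNReal.ofReal E) :
    ‖tensorCLM A (ContinuousLinearMap.id ℂ H₂) w‖ ≤ eNorm G₁ E A := by
  obtain ⟨l, c, hl, hc, hle, hd⟩ := hG₁.exists_dual hG₁' hE A
  rw [opTensorId, (isPositiveCore_tensorId H₂ hG₁).energy_le_iff hE.le] at he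
  have key : ‖tensorCLM A (ContinuousLinearMap.id ℂ H₂) w‖ ^ 2 ≤ l * E + c := by
    choose χ h1 h2 using fun n : ℕ => he (1 / ((n : ℝ) + 1)) (by positivity)
    have hχ : Tendsto (fun n => (χ n : HilbertTensor H₁ H₂)) atTop (𝓝 w) := by
      rw [tendsto_iff_norm_sub_tendsto_zero]
      exact squeeze_zero (fun _ => norm_nonneg _) (fun n => (h1 n).le)
        tendsto_one_div_add_atTop_nhds_zero_nat
    have hl1 := (((tensorCLM A (ContinuousLinearMap.id ℂ H₂)).continuous.tendsto w).comp
      hχ).norm.pow 2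
    have hl2 : Tendsto (fun n : ℕ => l * (E + 1 / ((n : ℝ) + 1)) +
        c * ‖(χ n : HilbertTensor H₁ H₂)‖ ^ 2) atTop (𝓝 (l * (E + 0) + c * ‖w‖ ^ 2)) :=
      (tendsto_const_nhds.mul (tendsto_const_nhds.add
        tendsto_one_div_add_atTop_nhds_zero_nat)).add (tendsto_const_nhds.mul (hχ.norm.pow 2))
    have := le_of_tendsto_of_tendsto' hl1 hl2 fun n => by
      have h3 := h2 n
      obtain ⟨ω, hω⟩ := tensorPMapMk_surjective (χ n)
      rw [← hω, re_inner_tensorPMap] at h3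
      have h4 := norm_tensorCLM_left_sq_le hd ω
      simp only [Function.comp_apply, ← hω, coe_tensorPMapMk]
      refine h4.trans ?_
      gcongr
    rwa [hw, add_zero, one_pow, mul_one] at this
  exact le_of_sq_le_sq (key.trans hle) (eNorm_nonneg _ _ _)

/-- Tensoring approximants of `φ` and `ψ` gives approximants of the product, with forms as in
`re_inner_tensorSum_tmul`; their norms tend to `1`. -/
theorem energy_tensorSum_tmul_le (hG₁ : IsPositiveSelfAdjoint G₁) (hG₂ : IsPositiveSelfAdjoint G₂)
    {x y : ℝ} (hx : 0 ≤ x) (hy : 0 ≤ y) {φ : H₁} {ψ : H₂} (hφ : ‖φ‖ = 1) (hψ : ‖ψ‖ = 1)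
    (h₁ : energy G₁ φ ≤ ENNReal.ofReal x) (h₂ : energy G₂ ψ ≤ ENNReal.ofReal y) :
    energy (opTensorSum G₁ G₂) (toHilbert H₁ H₂ (φ ⊗ₜ ψ)) ≤ ENNReal.ofReal (x + y) := by
  rw [opTensorSum, (isPositiveCore_tensorSum hG₁ hG₂).energy_le_iff (by positivity)]
  rw [hG₁.energy_le_iff hx] at h₁
  rw [hG₂.energy_le_iff hy] at h₂
  choose χ h1 h2 using fun n : ℕ => h₁ (1 / ((n : ℝ) + 1)) (by positivity)
  choose ξ h3 h4 using fun n : ℕ => h₂ (1 / ((n : ℝ) + 1)) (by positivity)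
  have hinv := tendsto_one_div_add_atTop_nhds_zero_nat (𝕜 := ℝ)
  have hχ : Tendsto (fun n => (χ n : H₁)) atTop (𝓝 φ) := by
    rw [tendsto_iff_norm_sub_tendsto_zero]
    exact squeeze_zero (fun _ => norm_nonneg _) (fun n => (h1 n).le) hinv
  have hξ : Tendsto (fun n => (ξ n : H₂)) atTop (𝓝 ψ) := by
    rw [tendsto_iff_norm_sub_tendsto_zero]
    exact squeeze_zero (fun _ => norm_nonneg _) (fun n => (h3 n).le) hinv
  have hten : Tendsto (fun n => toHilbert H₁ H₂ ((χ n : H₁) ⊗ₜ (ξ n : H₂))) atTop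
      (𝓝 (toHilbert H₁ H₂ (φ ⊗ₜ ψ))) := tendsto_toHilbert_tmul hχ hξ
  have hen : Tendsto (fun n : ℕ => (x + 1 / ((n : ℝ) + 1)) * ‖(ξ n : H₂)‖ ^ 2 +
      ‖(χ n : H₁)‖ ^ 2 * (y + 1 / ((n : ℝ) + 1))) atTop (𝓝 (x + y)) := by
    have := ((hinv.const_add x).mul (hξ.norm.pow 2)).add ((hχ.norm.pow 2).mul (hinv.const_add y))
    simpa [hφ, hψ] using this
  intro ε hε
  have hev := ((tendsto_iff_norm_sub_tendsto_zero.1 hten).eventually_lt_const hε).and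
    (hen.eventually_lt_const (show x + y < x + y + ε by linarith))
  obtain ⟨n, h5, h6⟩ := hev.exists
  refine ⟨tensorPMapMk _ (χ n ⊗ₜ ξ n), h5, ?_⟩
  rw [re_inner_tensorPMap]
  refine lt_of_le_of_lt ?_ h6
  rw [re_inner_tensorSum_tmul]
  gcongr
  · exact (h2 n).le
  · exact (h4 n).le

theorem InfIsZero.exists_energy_le {H : Type*} [NormedAddCommGroup H]
    [InnerProductSpace ℂ H] [CompleteSpace H] {G : H →ₗ.[ℂ] H} (hG : IsPositiveSelfAdjoint G)
    (hG' : InfIsZero G) {E : ℝ} (hE : 0 < E) :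
    ∃ φ : H, ‖φ‖ = 1 ∧ energy G φ ≤ ENNReal.ofReal E := by
  obtain ⟨φ, h1, h2⟩ := hG'.exists_lt hE
  exact ⟨φ, h1, hG.energy_le φ h2.le⟩

theorem eNorm_mul_eNorm_le (hG₁ : IsPositiveSelfAdjoint G₁) (hG₂ : IsPositiveSelfAdjoint G₂)
    {x y : ℝ} (hx : 0 ≤ x) (hy : 0 ≤ y) (A : H₁ →L[ℂ] H₁) (B : H₂ →L[ℂ] H₂) :
    eNorm G₁ x A * eNorm G₂ y B ≤ eNorm (opTensorSum G₁ G₂) (x + y) (tensorCLM A B) := by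
  set C := eNorm (opTensorSum G₁ G₂) (x + y) (tensorCLM A B)
  have hC : 0 ≤ C := eNorm_nonneg _ _ _
  have key : ∀ φ, ‖φ‖ = 1 → energy G₁ φ ≤ ENNReal.ofReal x → ∀ ψ, ‖ψ‖ = 1 →
      energy G₂ ψ ≤ ENNReal.ofReal y → ‖A φ‖ * ‖B ψ‖ ≤ C := by
    intro φ h1 h2 ψ h3 h4
    have := le_eNorm (tensorCLM A B) (φ := toHilbert H₁ H₂ (φ ⊗ₜ ψ))
      (by rw [norm_toHilbert_tmul, h1, h3, one_mul])
      (energy_tensorSum_tmul_le hG₁ hG₂ hx hy h1 h3 h2 h4)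
    rwa [tensorCLM_tmul, norm_toHilbert_tmul] at this
  rcases (eNorm_nonneg G₂ y B).eq_or_lt with h0 | h0
  · rwa [← h0, mul_zero]
  rw [← le_div_iff₀ h0]
  refine eNorm_le (by positivity) fun φ h1 h2 => ?_
  rw [le_div_iff₀ h0]
  rcases (norm_nonneg (A φ)).eq_or_lt with h0' | h0'
  · rwa [← h0', zero_mul]
  rw [mul_comm, ← le_div_iff₀ h0']
  refine eNorm_le (by positivity) fun ψ h3 h4 => ?_
  rw [le_div_iff₀ h0', mul_comm]
  exact key φ h1 h2 ψ h3 h4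

theorem le_of_forall_mul_le {a b : ℝ} (h : ∀ t : ℝ, 0 < t → t < 1 → t * a ≤ b) : a ≤ b := by
  have hl : Tendsto (fun t : ℝ => t * a) (𝓝[<] 1) (𝓝 (1 * a)) :=
    (Continuous.tendsto (by fun_prop) 1).mono_left nhdsWithin_le_nhds
  rw [one_mul] at hl
  refine le_of_tendsto hl ?_
  filter_upwards [Ioo_mem_nhdsLT (show (0 : ℝ) < 1 by norm_num)] with t ht
  exact h t ht.1 ht.2

theorem eNorm_le_eNorm_tensorSum (hG₁ : IsPositiveSelfAdjoint G₁) (hG₁' : InfIsZero G₁)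
    (hG₂ : IsPositiveSelfAdjoint G₂) (hG₂' : InfIsZero G₂) {E : ℝ} (hE : 0 < E)
    (A : H₁ →L[ℂ] H₁) :
    eNorm G₁ E A ≤
      eNorm (opTensorSum G₁ G₂) E (tensorCLM A (ContinuousLinearMap.id ℂ H₂)) := by
  refine le_of_sq_le_sq (le_of_forall_mul_le fun t ht ht1 => ?_) (eNorm_nonneg _ _ _)
  refine (hG₁.mul_eNorm_sq_le hG₁' A hE ht ht1.le).trans ?_
  refine pow_le_pow_left₀ (eNorm_nonneg _ _ _) ?_ 2
  -- The energy freed by passing to `t E` pays for a unit vector `ψ` of the second space, since the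
  -- infimum there need not be attained.
  have hy : 0 < E - t * E := by nlinarith
  obtain ⟨ψ, h1, h2⟩ := hG₂'.exists_energy_le hG₂ hy
  have h3 := le_eNorm (ContinuousLinearMap.id ℂ H₂) h1 h2
  rw [ContinuousLinearMap.id_apply, h1] at h3
  have h4 := eNorm_mul_eNorm_le hG₁ hG₂ (mul_pos ht hE).le hy.le A (ContinuousLinearMap.id ℂ H₂)
  rw [add_sub_cancel] at h4
  exact (le_mul_of_one_le_right (eNorm_nonneg _ _ _) h3).trans h4

theorem eNorm_tensorSum_eq (hG₁ : IsPositiveSelfAdjoint G₁) (hG₁' : InfIsZero G₁)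
    (hG₂ : IsPositiveSelfAdjoint G₂) (hG₂' : InfIsZero G₂) {E : ℝ} (hE : 0 < E)
    (A : H₁ →L[ℂ] H₁) :
    eNorm (opTensorSum G₁ G₂) E (tensorCLM A (ContinuousLinearMap.id ℂ H₂)) = eNorm G₁ E A := by
  refine le_antisymm (eNorm_le (eNorm_nonneg _ _ _) fun w h1 h2 => ?_)
    (eNorm_le_eNorm_tensorSum hG₁ hG₁' hG₂ hG₂' hE A)
  obtain ⟨α, β, hα, hβ, hαβ, hA, -⟩ := exists_energy_split hG₁ hG₂ hE.le h1 h2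
  have := hG₁.mul_le_eNorm_sq hG₁' (hA A) hE zero_le_one le_rfl (by linarith)
  rw [one_mul] at this
  exact le_of_sq_le_sq this (eNorm_nonneg _ _ _)

theorem eNorm_tensorId_eq (hG₁ : IsPositiveSelfAdjoint G₁) (hG₁' : InfIsZero G₁)
    (hG₂' : InfIsZero G₂) {E : ℝ} (hE : 0 < E) (A : H₁ →L[ℂ] H₁) :
    eNorm (opTensorId H₂ G₁) E (tensorCLM A (ContinuousLinearMap.id ℂ H₂)) = eNorm G₁ E A := by
  refine le_antisymm (eNorm_le (eNorm_nonneg _ _ _) fun w h1 h2 =>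
    norm_tensorCLM_le_of_energy_tensorId_le hG₁ hG₁' hE A h1 h2)
    (eNorm_le (eNorm_nonneg _ _ _) fun φ h1 h2 => ?_)
  obtain ⟨ψ, hψ, -⟩ := hG₂'.exists_lt one_pos
  have := le_eNorm (tensorCLM A (ContinuousLinearMap.id ℂ H₂))
    (φ := toHilbert H₁ H₂ (φ ⊗ₜ (ψ : H₂))) (by rw [norm_toHilbert_tmul, h1, hψ, one_mul])
    (energy_tensorId_tmul_le hG₁ hE.le hψ h2)
  rwa [tensorCLM_tmul, norm_toHilbert_tmul, ContinuousLinearMap.id_apply, hψ, mul_one] at this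

/-- Cauchy–Schwarz after moving the self-adjoint `A*A ⊗ I` to the other side of `⟪w, (A*A ⊗ B*B)
w⟫`. -/
theorem norm_tensorCLM_sq_le_mul (A : H₁ →L[ℂ] H₁) (B : H₂ →L[ℂ] H₂) (w : HilbertTensor H₁ H₂) :
    ‖tensorCLM A B w‖ ^ 2 ≤
      ‖tensorCLM (ContinuousLinearMap.adjoint A ∘L A) (ContinuousLinearMap.id ℂ H₂) w‖ *
        ‖tensorCLM (ContinuousLinearMap.id ℂ H₁) (ContinuousLinearMap.adjoint B ∘L B) w‖ := by
  set A' := ContinuousLinearMap.adjoint A ∘L A with hA'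
  have hAa : ContinuousLinearMap.adjoint A' = A' := by
    rw [hA', ContinuousLinearMap.adjoint_comp, ContinuousLinearMap.adjoint_adjoint]
  have h : tensorCLM A' (ContinuousLinearMap.adjoint B ∘L B) =
      ContinuousLinearMap.adjoint (tensorCLM A' (ContinuousLinearMap.id ℂ H₂)) ∘L
        tensorCLM (ContinuousLinearMap.id ℂ H₁) (ContinuousLinearMap.adjoint B ∘L B) := by
    rw [adjoint_tensorCLM, hAa, tensorCLM_comp, ContinuousLinearMap.adjoint_id,
      ContinuousLinearMap.id_comp, ContinuousLinearMap.comp_id]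
  rw [norm_tensorCLM_sq, h, ContinuousLinearMap.comp_apply,
    ContinuousLinearMap.adjoint_inner_right]
  exact re_inner_le_norm (𝕜 := ℂ) _ _

theorem eNorm_tensorSum_le_iSup (hG₁ : IsPositiveSelfAdjoint G₁) (hG₁' : InfIsZero G₁)
    (hG₂ : IsPositiveSelfAdjoint G₂) (hG₂' : InfIsZero G₂) {E : ℝ} (hE : 0 < E)
    (A : H₁ →L[ℂ] H₁) (B : H₂ →L[ℂ] H₂) :
    eNorm (opTensorSum G₁ G₂) E (tensorCLM A B) ≤ ⨆ x : Set.Ioo (0 : ℝ) E,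
      √(eNorm G₁ x (ContinuousLinearMap.adjoint A ∘L A) *
        eNorm G₂ (E - x) (ContinuousLinearMap.adjoint B ∘L B)) := by
  set A' := ContinuousLinearMap.adjoint A ∘L A
  set B' := ContinuousLinearMap.adjoint B ∘L B
  have hbdd : BddAbove (Set.range fun x : Set.Ioo (0 : ℝ) E =>
      √(eNorm G₁ x A' * eNorm G₂ (E - x) B')) := by
    refine ⟨√(‖A'‖ * ‖B'‖), ?_⟩
    rintro _ ⟨x, rfl⟩
    exact Real.sqrt_le_sqrt (mul_le_mul (eNorm_le_opNorm _ _ _) (eNorm_le_opNorm _ _ _)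
      (eNorm_nonneg _ _ _) (norm_nonneg _))
  set S := ⨆ x : Set.Ioo (0 : ℝ) E, √(eNorm G₁ x A' * eNorm G₂ (E - x) B')
  have hS : 0 ≤ S := Real.iSup_nonneg fun x => Real.sqrt_nonneg _
  refine eNorm_le hS fun w h1 h2 => ?_
  obtain ⟨α, β, hα, hβ, hαβ, hA, hB⟩ := exists_energy_split hG₁ hG₂ hE.le h1 h2
  refine le_of_sq_le_sq (le_of_forall_mul_le fun t ht ht1 => ?_) hS
  -- Mixing with the midpoint keeps `x` inside `(0, E)` even when `α` is `0` or `E`, while `t α ≤ x`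
  -- and `t β ≤ E - x`.
  set x := t * α + (1 - t) * (E / 2) with hx
  have h1t : 0 < (1 - t) * (E / 2) := mul_pos (by linarith) (by linarith)
  have htα : 0 ≤ t * α := by positivity
  have htβ : 0 ≤ t * β := by positivity
  have htE : t * (α + β) ≤ t * E := by gcongr
  have hx0 : 0 < x := by linarith
  have hxE : t * β + (1 - t) * (E / 2) ≤ E - x := by rw [hx]; linarith
  have hEx : 0 < E - x := by linarith
  have h3 := hG₁.mul_le_eNorm_sq hG₁' (hA A') hx0 ht.le ht1.le (by linarith)
  have h4 := hG₂.mul_le_eNorm_sq hG₂' (hB B') hEx ht.le ht1.le (by linarith)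
  set n₁ := ‖tensorCLM A' (ContinuousLinearMap.id ℂ H₂) w‖
  set n₂ := ‖tensorCLM (ContinuousLinearMap.id ℂ H₁) B' w‖
  have h5 : t * (n₁ * n₂) ≤ eNorm G₁ x A' * eNorm G₂ (E - x) B' := by
    refine le_of_sq_le_sq ?_ (mul_nonneg (eNorm_nonneg _ _ _) (eNorm_nonneg _ _ _))
    calc (t * (n₁ * n₂)) ^ 2 = (t * n₁ ^ 2) * (t * n₂ ^ 2) := by ring
      _ ≤ eNorm G₁ x A' ^ 2 * eNorm G₂ (E - x) B' ^ 2 := by gcongr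
      _ = _ := by ring
  have h6 : √(eNorm G₁ x A' * eNorm G₂ (E - x) B') ≤ S :=
    le_ciSup hbdd (⟨x, hx0, by linarith⟩ : Set.Ioo (0 : ℝ) E)
  rw [Real.sqrt_le_left hS] at h6
  refine le_trans ?_ (h5.trans h6)
  gcongr
  exact norm_tensorCLM_sq_le_mul A B w

theorem eNorm_tensorSum_le_left (hG₁ : IsPositiveSelfAdjoint G₁) (hG₁' : InfIsZero G₁)
    (hG₂ : IsPositiveSelfAdjoint G₂) {E : ℝ} (hE : 0 < E)
    (A : H₁ →L[ℂ] H₁) (B : H₂ →L[ℂ] H₂) :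
    eNorm (opTensorSum G₁ G₂) E (tensorCLM A B) ≤ eNorm G₁ E A * ‖B‖ := by
  refine eNorm_le (mul_nonneg (eNorm_nonneg _ _ _) (norm_nonneg _)) fun w h1 h2 => ?_
  obtain ⟨α, β, hα, hβ, hαβ, hA, -⟩ := exists_energy_split hG₁ hG₂ hE.le h1 h2
  have := hG₁.mul_le_eNorm_sq hG₁' (hA A) hE zero_le_one le_rfl (by linarith)
  rw [one_mul] at this
  have h3 := le_of_sq_le_sq this (eNorm_nonneg _ _ _)
  have h4 : tensorCLM A B =
      tensorCLM (ContinuousLinearMap.id ℂ H₁) B ∘L tensorCLM A (ContinuousLinearMap.id ℂ H₂) := by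
    rw [tensorCLM_comp, ContinuousLinearMap.id_comp, ContinuousLinearMap.comp_id]
  rw [h4, ContinuousLinearMap.comp_apply, mul_comm]
  exact (norm_tensorCLM_id_left_le B _).trans (by gcongr)

theorem eNorm_tensorSum_le_right (hG₁ : IsPositiveSelfAdjoint G₁)
    (hG₂ : IsPositiveSelfAdjoint G₂) (hG₂' : InfIsZero G₂) {E : ℝ} (hE : 0 < E)
    (A : H₁ →L[ℂ] H₁) (B : H₂ →L[ℂ] H₂) :
    eNorm (opTensorSum G₁ G₂) E (tensorCLM A B) ≤ ‖A‖ * eNorm G₂ E B := by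
  refine eNorm_le (mul_nonneg (norm_nonneg _) (eNorm_nonneg _ _ _)) fun w h1 h2 => ?_
  obtain ⟨α, β, hα, hβ, hαβ, -, hB⟩ := exists_energy_split hG₁ hG₂ hE.le h1 h2
  have := hG₂.mul_le_eNorm_sq hG₂' (hB B) hE zero_le_one le_rfl (by linarith)
  rw [one_mul] at this
  have h3 := le_of_sq_le_sq this (eNorm_nonneg _ _ _)
  have h4 : tensorCLM A B =
      tensorCLM A (ContinuousLinearMap.id ℂ H₂) ∘L tensorCLM (ContinuousLinearMap.id ℂ H₁) B := by
    rw [tensorCLM_comp, ContinuousLinearMap.id_comp, ContinuousLinearMap.comp_id]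
  rw [h4, ContinuousLinearMap.comp_apply]
  exact (norm_tensorCLM_id_right_le A _).trans (by gcongr)

end Main

end OperatorENorm

end

open OperatorENorm in
theorem proposition5 {H₁ H₂ : Type*}
    [NormedAddCommGroup H₁] [InnerProductSpace ℂ H₁] [CompleteSpace H₁]
    [NormedAddCommGroup H₂] [InnerProductSpace ℂ H₂] [CompleteSpace H₂]
    (G₁ : H₁ →ₗ.[ℂ] H₁) (G₂ : H₂ →ₗ.[ℂ] H₂)
    (hG₁ : IsPositiveSelfAdjoint G₁) (hG₁' : InfIsZero G₁)
    (hG₂ : IsPositiveSelfAdjoint G₂) (hG₂' : InfIsZero G₂)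
    (E : ℝ) (hE : 0 < E) :
    (∀ A : H₁ →L[ℂ] H₁,
      eNorm (opTensorSum G₁ G₂) E (tensorCLM A (ContinuousLinearMap.id ℂ H₂)) =
          eNorm (opTensorId H₂ G₁) E (tensorCLM A (ContinuousLinearMap.id ℂ H₂)) ∧
        eNorm (opTensorId H₂ G₁) E (tensorCLM A (ContinuousLinearMap.id ℂ H₂)) =
          eNorm G₁ E A) ∧
    (∀ (A : H₁ →L[ℂ] H₁) (B : H₂ →L[ℂ] H₂),
      (⨆ x : Set.Ioo (0 : ℝ) E, eNorm G₁ x A * eNorm G₂ (E - x) B) ≤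
          eNorm (opTensorSum G₁ G₂) E (tensorCLM A B) ∧
        eNorm (opTensorSum G₁ G₂) E (tensorCLM A B) ≤
          (⨆ x : Set.Ioo (0 : ℝ) E,
            √(eNorm G₁ x (ContinuousLinearMap.adjoint A ∘L A) *
              eNorm G₂ (E - x) (ContinuousLinearMap.adjoint B ∘L B))) ∧
        eNorm (opTensorSum G₁ G₂) E (tensorCLM A B) ≤
          min (eNorm G₁ E A * ‖B‖) (‖A‖ * eNorm G₂ E B)) := by
  refine ⟨fun A => ⟨?_, eNorm_tensorId_eq hG₁ hG₁' hG₂' hE A⟩, fun A B => ⟨?_,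
    eNorm_tensorSum_le_iSup hG₁ hG₁' hG₂ hG₂' hE A B,
    le_min (eNorm_tensorSum_le_left hG₁ hG₁' hG₂ hE A B)
      (eNorm_tensorSum_le_right hG₁ hG₂ hG₂' hE A B)⟩⟩
  · rw [eNorm_tensorSum_eq hG₁ hG₁' hG₂ hG₂' hE A, eNorm_tensorId_eq hG₁ hG₁' hG₂' hE A]
  · have : Nonempty (Set.Ioo (0 : ℝ) E) := ⟨⟨E / 2, by constructor <;> linarith⟩⟩
    refine ciSup_le fun x => ?_
    have := eNorm_mul_eNorm_le hG₁ hG₂ x.2.1.le (sub_nonneg.2 x.2.2.le) A B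
    rwa [add_sub_cancel] at this
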